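/- **Notation.** Let $m\ge 1$ and let $\mathbb F_m$ be the free group on $x_1,\dots,x_m$. A *$C$-group* is a group $G$ with a finite presentation on some generators $x_1,\dots,x_n$ all of whose relators have the form $x_i^{-1}w^{-1}x_jw$ with $w\in\mathbb F_n$; its *$C$-generators* are the conjugates in $G$ of the images of $x_1,\dots,x_n$. A *$C$-isomorphism* is a group isomorphism such that it and its inverse send $C$-generators to $C$-generators. The class $\mathcal C_{\Delta^2,m}$ consists of the $C$-groups that are $C$-isomorphic to a group $\langle x_1,\dots,x_m\mid W\rangle$, where $W\subset\mathbb F_m$ is a finite set of words of the form $x_i^{-1}w^{-1}x_jw$ that contains $[x_i^{-1},x_1\cdots x_m]=x_i^{-1}(x_1\cdots x_m)x_i(x_1\cdots x_m)^{-1}$ for every $i=1,\dots,m$. Let $Br_M$ be the braid group with standard generators $a_1,\dots,a_{M-1}$, acting (from the left) on $\mathbb F_M$ by $a_i(x_i)=x_ix_{i+1}x_i^{-1}$, $a_i(x_{i+1})=x_i$, and $a_i(x_j)=x_j$ for $j\ne i,i+1$. For $k\le M$ let $\Delta_k=(a_1\cdots a_{k-1})(a_1\cdots a_{k-2})\cdots(a_1a_2)a_1\in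 Br_M$. For $m\le M$ let $D_{m,M}\subset Br_M$ be the set of all conjugates in $Br_M$ of $a_1$ (if $M\ge 2$) and of $\Delta_m^2$, and let $\mathcal D_{m,M}$ be the semigroup generated by the alphabet $D_{m,M}$ with the relations $u_1\cdot u_2=u_2\cdot(u_2^{-1}u_1u_2)$ if $u_2\ne 1$, $u_1\cdot u_2=(u_1u_2u_1^{-1})\cdot u_1$ if $u_1\neq 1$, and $u\cdot 1=1\cdot u=u$ if $1\in D_{m,M}$. Let $\alpha:\mathcal D_{m,M}\to Br_M$ be the homomorphism with $\alpha(u)=u$ for $u\in D_{m,M}$. For $s=u_1\cdot\ldots\cdot u_n\in\mathcal D_{m,M}$ let $B_s\subset Br_M$ be the subgroup generated by $u_1,\dots,u_n$ (it depends only on $s$), and let $$G(s)=\langle x_1,\dots,x_M\mid x_i^{-1}b(x_i)=1,\ i=1,\dots,M,\ b\in B_s\rangle,$$ a $C$-group whose $C$-generators are the conjugates of the images of $x_1,\dots,x_M$. **Theorem.** Let $m\ge 1$ and let $G$ be a $C$-group in $\mathcal C_{\Delta^2,m}$. Then there are an integer $M\ge m$ and an element $s\in\mathcal D_{m,M}$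 such that (i) $\alpha(s)=\Delta_M^2$; (ii) $G$ and $G(s)$ are $C$-isomorphic. -/

import Mathlib

/-! ### Groups with a distinguished set of `C`-generators -/

namespace CGrp

/-- A relator `x_i⁻¹ w⁻¹ x_j w`, i.e. the relation `x_i = w⁻¹ x_j w`. -/
def IsCRelator {m : ℕ} (r : FreeGroup (Fin m)) : Prop :=
  ∃ (i j : Fin m) (w : FreeGroup (Fin m)),
    r = (FreeGroup.of i)⁻¹ * w⁻¹ * FreeGroup.of j * w

/-- The `C`-generators of the group `G(W) = ⟨x_1, …, x_m ∣ W⟩`: all conjugates of the images of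
the letters `x_i`. -/
def presGens {m : ℕ} (W : Set (FreeGroup (Fin m))) : Set (PresentedGroup W) :=
  Group.conjugatesOfSet (Set.range fun i : Fin m => PresentedGroup.of i)

/-- A homomorphism that sends `C`-generators to `C`-generators. -/
def IsCHom {G H : Type*} [Group G] [Group H] (S : Set G) (T : Set H) (f : G →* H) : Prop :=
  ∀ g ∈ S, f g ∈ T

/-- `C`-isomorphism of the groups `G`, `H` with sets of `C`-generators `S`, `T`: a group
isomorphism such that it and its inverse are `C`-homomorphisms. -/
def CIsomorphic {G H : Type*} [Group G] [Group H] (S : Set G) (T : Set H) : Prop :=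
  ∃ e : G ≃* H, IsCHom S T e.toMonoidHom ∧ IsCHom T S e.symm.toMonoidHom

/-- `G`, with set of `C`-generators `S`, is a `C`-group: it has a finite presentation whose
relators are all of the form `x_i⁻¹ w⁻¹ x_j w`, and `S` consists of the conjugates of the
generators of this presentation. -/
def IsCGroup {G : Type*} [Group G] (S : Set G) : Prop :=
  ∃ (m : ℕ) (W : Set (FreeGroup (Fin m))),
    W.Finite ∧ (∀ r ∈ W, IsCRelator r) ∧ CIsomorphic S (presGens W)

/-- The element `x_1 ⋯ x_m` of the free group. -/
def prodX (m : ℕ) : FreeGroup (Fin m) :=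
  (List.ofFn fun i : Fin m => FreeGroup.of i).prod

/-- The class `𝒞_{Δ²,m}`: the `C`-groups that are `C`-isomorphic to one given by a finite
`C`-presentation on `x_1, …, x_m` whose relators include all the commutators
`[x_i⁻¹, x_1 ⋯ x_m] = x_i⁻¹ (x_1 ⋯ x_m) x_i (x_1 ⋯ x_m)⁻¹`. -/
def InCDelta (m : ℕ) {G : Type*} [Group G] (S : Set G) : Prop :=
  IsCGroup S ∧
    ∃ W : Set (FreeGroup (Fin m)),
      W.Finite ∧ (∀ r ∈ W, IsCRelator r) ∧
        (∀ i : Fin m, (FreeGroup.of i)⁻¹ * prodX m * FreeGroup.of i * (prodX m)⁻¹ ∈ W) ∧ CIsomorphic S (presGens W)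

end CGrp

/-! ### Braid groups and their action on free groups -/

namespace Braid

/-- The defining relators of the braid group on `n` strings. The letter with index `i` (counted
from `0`) stands for `a_{i+1}`. -/
def rels (n : ℕ) : Set (FreeGroup (Fin (n - 1))) :=
  {r | ∃ i j : Fin (n - 1), i.val + 1 = j.val ∧
      r = FreeGroup.of i * FreeGroup.of j * FreeGroup.of i *
        (FreeGroup.of j * FreeGroup.of i * FreeGroup.of j)⁻¹} ∪
  {r | ∃ i j : Fin (n - 1), i.val + 2 ≤ j.val ∧
      r = FreeGroup.of i * FreeGroup.of j * (FreeGroup.of j * FreeGroup.of i)⁻¹}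

/-- The braid group `Br_n`. -/
abbrev Br (n : ℕ) : Type := PresentedGroup (rels n)

/-- The standard generator `a_{i+1}` of `Br_n`, for `i + 1 < n` (and `1` for other `i`). -/
def gen (n i : ℕ) : Br n :=
  if h : i < n - 1 then PresentedGroup.of ⟨i, h⟩ else 1

/-- The Garside element
`Δ_k = (a_1 ⋯ a_{k-1}) (a_1 ⋯ a_{k-2}) ⋯ (a_1 a_2) a_1`, as an element of `Br_n`, `k ≤ n`. -/
def garside (n k : ℕ) : Br n :=
  ((List.range k).reverse.map fun l => ((List.range l).map (gen n)).prod).prod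

/-- The endomorphism `x_p ↦ x_p x_q x_p⁻¹`, `x_q ↦ x_p` of a free group. -/
def twistHom {α : Type*} [DecidableEq α] (p q : α) : FreeGroup α →* FreeGroup α :=
  FreeGroup.lift fun j =>
    if j = p then FreeGroup.of p * FreeGroup.of q * (FreeGroup.of p)⁻¹
    else if j = q then FreeGroup.of p else FreeGroup.of j

/-- The inverse endomorphism `x_p ↦ x_q`, `x_q ↦ x_q⁻¹ x_p x_q`. -/
def twistInv {α : Type*} [DecidableEq α] (p q : α) : FreeGroup α →* FreeGroup α :=
  FreeGroup.lift fun j =>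
    if j = p then FreeGroup.of q
    else if j = q then (FreeGroup.of q)⁻¹ * FreeGroup.of p * FreeGroup.of q else FreeGroup.of j

theorem twistHom_of {α : Type*} [DecidableEq α] (p q j : α) :
    twistHom p q (FreeGroup.of j) =
      if j = p then FreeGroup.of p * FreeGroup.of q * (FreeGroup.of p)⁻¹
      else if j = q then FreeGroup.of p else FreeGroup.of j := by
  simp [twistHom]

theorem twistInv_of {α : Type*} [DecidableEq α] (p q j : α) :
    twistInv p q (FreeGroup.of j) =
      if j = p then FreeGroup.of q
      else if j = q then (FreeGroup.of q)⁻¹ * FreeGroup.of p * FreeGroup.of q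
      else FreeGroup.of j := by
  simp [twistInv]

/-- `twistHom p q`, for `p ≠ q`, as an automorphism. -/
def twist {α : Type*} [DecidableEq α] (p q : α) (h : p ≠ q) : MulAut (FreeGroup α) :=
  MonoidHom.toMulEquiv (twistHom p q) (twistInv p q)
    (by
      ext j
      by_cases h1 : j = p
      · subst h1; simp [twistHom_of, twistInv_of, h.symm, mul_assoc]
      · by_cases h2 : j = q
        · subst h2; simp [twistHom_of, twistInv_of, h1]
        · simp [twistHom_of, twistInv_of, h1, h2])
    (by
      ext j
      by_cases h1 : j = p
      · subst h1; simp [twistHom_of, twistInv_of, h.symm]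
      · by_cases h2 : j = q
        · subst h2; simp [twistHom_of, twistInv_of, h1, mul_assoc]
        · simp [twistHom_of, twistInv_of, h1, h2])

theorem twist_of {α : Type*} [DecidableEq α] (p q : α) (h : p ≠ q) (j : α) :
    twist p q h (FreeGroup.of j) =
      if j = p then FreeGroup.of p * FreeGroup.of q * (FreeGroup.of p)⁻¹
      else if j = q then FreeGroup.of p else FreeGroup.of j :=
  twistHom_of p q j

theorem mulAut_ext {α : Type*} {f g : MulAut (FreeGroup α)}
    (h : ∀ j, f (FreeGroup.of j) = g (FreeGroup.of j)) : f = g := by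
  have : f.toMonoidHom = g.toMonoidHom := FreeGroup.ext_hom _ _ h
  exact MulEquiv.toMonoidHom_injective this

theorem twist_braid {α : Type*} [DecidableEq α] (p q r : α) (hpq : p ≠ q) (hqr : q ≠ r)
    (hpr : p ≠ r) :
    twist p q hpq * twist q r hqr * twist p q hpq =
      twist q r hqr * twist p q hpq * twist q r hqr := by
  apply mulAut_ext
  intro j
  simp only [MulAut.mul_apply, twist_of]
  by_cases h1 : j = p
  · subst h1; simp [twist_of, hpq, hpq.symm, hqr.symm, hpr, hpr.symm, mul_assoc]
  · by_cases h2 : j = q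
    · subst h2; simp [twist_of, hpq, hpq.symm, hqr.symm, hpr, hpr.symm, mul_assoc]
    · by_cases h3 : j = r
      · subst h3; simp [twist_of, hpq, hpq.symm, hqr.symm, hpr, hpr.symm]
      · simp [twist_of, h1, h2, h3]

theorem twist_comm {α : Type*} [DecidableEq α] (p q r s : α) (hpq : p ≠ q) (hrs : r ≠ s)
    (hpr : p ≠ r) (hps : p ≠ s) (hqr : q ≠ r) (hqs : q ≠ s) :
    twist p q hpq * twist r s hrs = twist r s hrs * twist p q hpq := by
  apply mulAut_ext
  intro j
  simp only [MulAut.mul_apply, twist_of]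
  by_cases h1 : j = p
  · subst h1; simp [twist_of, hpr, hps, hqr, hqs]
  · by_cases h2 : j = q
    · subst h2; simp [twist_of, h1, hpr, hps, hqr, hqs]
    · by_cases h3 : j = r
      · subst h3; simp [twist_of, h1, h2, hps.symm, hqs.symm]
      · by_cases h4 : j = s
        · subst h4; simp [twist_of, h1, h2, h3, hpr.symm, hqr.symm]
        · simp [twist_of, h1, h2, h3, h4]

/-- The automorphism by which a standard generator acts:
`a_i(x_i) = x_i x_{i+1} x_i⁻¹`, `a_i(x_{i+1}) = x_i`, and `a_i(x_j) = x_j` for `j ≠ i, i + 1`. -/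
def genAut {n : ℕ} (i : Fin (n - 1)) : MulAut (FreeGroup (Fin n)) :=
  twist ⟨i.val, by omega⟩ ⟨i.val + 1, by omega⟩ (by simp)

theorem genAut_rels (n : ℕ) : ∀ r ∈ rels n, FreeGroup.lift (genAut (n := n)) r = 1 := by
  rintro r (⟨i, j, hij, rfl⟩ | ⟨i, j, hij, rfl⟩)
  · simp only [map_mul, map_inv, FreeGroup.lift_apply_of, mul_inv_eq_one]
    obtain ⟨i, hi⟩ := i
    obtain ⟨j, hj⟩ := j
    obtain rfl : i + 1 = j := hij
    exact twist_braid _ _ _ _ _ (by simp only [ne_eq, Fin.mk.injEq]; omega)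
  · simp only [map_mul, map_inv, FreeGroup.lift_apply_of, mul_inv_eq_one]
    apply twist_comm <;> simp only [ne_eq, Fin.mk.injEq] <;> omega

/-- The standard action of `Br_n` on the free group `⟨x_1, …, x_n⟩`;
`(b b')(w) = b(b'(w))`. -/
def action (n : ℕ) : Br n →* MulAut (FreeGroup (Fin n)) :=
  PresentedGroup.toGroup (genAut_rels n)

end Braid

/-! ### Factorization semigroups -/

namespace Factorization

/-- The relations of the factorization semigroup over `(A, U)`; a letter of value `1` is deleted. -/
inductive Rel {A : Type*} [Group A] (U : Set A) : FreeSemigroup U → FreeSemigroup U → Prop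
  | right (u₁ u₂ v : U) (h : (u₂ : A) ≠ 1) (hv : (v : A) = (u₂ : A)⁻¹ * u₁ * u₂) :
      Rel U (FreeSemigroup.of u₁ * FreeSemigroup.of u₂) (FreeSemigroup.of u₂ * FreeSemigroup.of v)
  | right_one (u₁ u₂ : U) (h : (u₂ : A) = 1) :
      Rel U (FreeSemigroup.of u₁ * FreeSemigroup.of u₂) (FreeSemigroup.of u₁)
  | left (u₁ u₂ v : U) (h : (u₁ : A) ≠ 1) (hv : (v : A) = (u₁ : A) * u₂ * (u₁ : A)⁻¹) :
      Rel U (FreeSemigroup.of u₁ * FreeSemigroup.of u₂) (FreeSemigroup.of v * FreeSemigroup.of u₁)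
  | left_one (u₁ u₂ : U) (h : (u₁ : A) = 1) :
      Rel U (FreeSemigroup.of u₁ * FreeSemigroup.of u₂) (FreeSemigroup.of u₂)

/-- The factorization semigroup `S(A, U)`, where `U` is a union of conjugacy classes of `A`. -/
abbrev Semi {A : Type*} [Group A] (U : Set A) : Type _ := (conGen (Rel U)).Quotient

/-- The product of a word in the alphabet `U`. -/
def wordProd {A : Type*} [Group A] (U : Set A) : FreeSemigroup U →ₙ* A :=
  FreeSemigroup.lift fun u : U => (u : A)

theorem wordProd_eq {A : Type*} [Group A] (U : Set A) (w w' : FreeSemigroup U)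
    (h : conGen (Rel U) w w') : wordProd U w = wordProd U w' := by
  have hle : conGen (Rel U) ≤ Con.ker (wordProd U) := by
    rw [Con.conGen_le]
    rintro x y (⟨u₁, u₂, v, -, hv⟩ | ⟨u₁, u₂, h⟩ | ⟨u₁, u₂, v, -, hv⟩ | ⟨u₁, u₂, h⟩) <;>
      simp_all [Con.ker_rel, wordProd, mul_assoc]
  exact hle h

/-- The product homomorphism `α : S(A, U) → A`. -/
def prodHom {A : Type*} [Group A] (U : Set A) : Semi U →ₙ* A where
  toFun s := Con.liftOn s (wordProd U) (wordProd_eq U)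
  map_mul' s t := Con.induction_on₂ s t fun x y => map_mul (wordProd U) x y

/-- The subgroup generated by the letters of a word. -/
def wordSubgroup {A : Type*} [Group A] (U : Set A) (w : FreeSemigroup U) : Subgroup A :=
  Subgroup.closure {g | ∃ u ∈ w.head :: w.tail, (u : A) = g}

theorem wordSubgroup_mul {A : Type*} [Group A] (U : Set A) (w w' : FreeSemigroup U) :
    wordSubgroup U (w * w') = wordSubgroup U w ⊔ wordSubgroup U w' := by
  rw [wordSubgroup, wordSubgroup, wordSubgroup, ← Subgroup.closure_union]
  congr 1
  ext g
  simp only [FreeSemigroup.head_mul, FreeSemigroup.tail_mul, List.mem_cons, List.mem_append,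
    Set.mem_union, Set.mem_ofPred_eq]
  constructor
  · rintro ⟨u, h | h | h | h, rfl⟩ <;> simp [h]
  · rintro (⟨u, h | h, rfl⟩ | ⟨u, h | h, rfl⟩) <;> refine ⟨u, ?_, rfl⟩ <;> simp [h]

theorem wordSubgroup_of {A : Type*} [Group A] (U : Set A) (u : U) :
    wordSubgroup U (FreeSemigroup.of u) = Subgroup.zpowers (u : A) := by
  rw [wordSubgroup, Subgroup.zpowers_eq_closure]
  congr 1
  ext g
  simp [eq_comm]

theorem wordSubgroup_eq {A : Type*} [Group A] (U : Set A) (w w' : FreeSemigroup U)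
    (h : conGen (Rel U) w w') : wordSubgroup U w = wordSubgroup U w' := by
  let c : Con (FreeSemigroup U) :=
    { r := fun x y => wordSubgroup U x = wordSubgroup U y
      iseqv := ⟨fun _ => rfl, fun h => h.symm, fun h h' => h.trans h'⟩
      mul' := by
        intro a b x y h h'
        rw [wordSubgroup_mul, wordSubgroup_mul, h, h'] }
  have hle : conGen (Rel U) ≤ c := by
    rw [Con.conGen_le]
    rintro x y (⟨u₁, u₂, v, -, hv⟩ | ⟨u₁, u₂, h⟩ | ⟨u₁, u₂, v, -, hv⟩ | ⟨u₁, u₂, h⟩)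
    · show wordSubgroup U _ = wordSubgroup U _
      simp only [wordSubgroup_mul, wordSubgroup_of, hv]
      apply le_antisymm
      · refine sup_le ?_ le_sup_left
        rw [Subgroup.zpowers_le]
        have h2 : (u₂ : A) ∈ Subgroup.zpowers (u₂ : A) ⊔
            Subgroup.zpowers ((u₂ : A)⁻¹ * u₁ * u₂) :=
          (le_sup_left : Subgroup.zpowers (u₂ : A) ≤ _) (Subgroup.mem_zpowers _)
        have h1 : (u₂ : A)⁻¹ * u₁ * u₂ ∈ Subgroup.zpowers (u₂ : A) ⊔
            Subgroup.zpowers ((u₂ : A)⁻¹ * u₁ * u₂) :=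
          (le_sup_right : Subgroup.zpowers ((u₂ : A)⁻¹ * u₁ * u₂) ≤ _) (Subgroup.mem_zpowers _)
        have := mul_mem (mul_mem h2 h1) (inv_mem h2)
        simpa [mul_assoc] using this
      · refine sup_le le_sup_right ?_
        rw [Subgroup.zpowers_le]
        have h2 : (u₂ : A) ∈ Subgroup.zpowers (u₁ : A) ⊔ Subgroup.zpowers (u₂ : A) :=
          (le_sup_right : Subgroup.zpowers (u₂ : A) ≤ _) (Subgroup.mem_zpowers _)
        have h1 : (u₁ : A) ∈ Subgroup.zpowers (u₁ : A) ⊔ Subgroup.zpowers (u₂ : A) :=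
          (le_sup_left : Subgroup.zpowers (u₁ : A) ≤ _) (Subgroup.mem_zpowers _)
        exact mul_mem (mul_mem (inv_mem h2) h1) h2
    · show wordSubgroup U _ = wordSubgroup U _
      simp [wordSubgroup_mul, wordSubgroup_of, h]
    · show wordSubgroup U _ = wordSubgroup U _
      simp only [wordSubgroup_mul, wordSubgroup_of, hv]
      apply le_antisymm
      · refine sup_le le_sup_right ?_
        rw [Subgroup.zpowers_le]
        have h2 : (u₁ : A) ∈ Subgroup.zpowers ((u₁ : A) * u₂ * (u₁ : A)⁻¹) ⊔
            Subgroup.zpowers (u₁ : A) :=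
          (le_sup_right : Subgroup.zpowers (u₁ : A) ≤ _) (Subgroup.mem_zpowers _)
        have h1 : (u₁ : A) * u₂ * (u₁ : A)⁻¹ ∈ Subgroup.zpowers ((u₁ : A) * u₂ * (u₁ : A)⁻¹) ⊔
            Subgroup.zpowers (u₁ : A) :=
          (le_sup_left : Subgroup.zpowers ((u₁ : A) * u₂ * (u₁ : A)⁻¹) ≤ _)
            (Subgroup.mem_zpowers _)
        have := mul_mem (mul_mem (inv_mem h2) h1) h2
        simpa [mul_assoc] using this
      · refine sup_le ?_ le_sup_left
        rw [Subgroup.zpowers_le]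
        have h2 : (u₂ : A) ∈ Subgroup.zpowers (u₁ : A) ⊔ Subgroup.zpowers (u₂ : A) :=
          (le_sup_right : Subgroup.zpowers (u₂ : A) ≤ _) (Subgroup.mem_zpowers _)
        have h1 : (u₁ : A) ∈ Subgroup.zpowers (u₁ : A) ⊔ Subgroup.zpowers (u₂ : A) :=
          (le_sup_left : Subgroup.zpowers (u₁ : A) ≤ _) (Subgroup.mem_zpowers _)
        exact mul_mem (mul_mem h1 h2) (inv_mem h1)
    · show wordSubgroup U _ = wordSubgroup U _
      simp [wordSubgroup_mul, wordSubgroup_of, h]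
  exact hle h

/-- The subgroup `B_s` generated by the factors of `s ∈ S(A, U)`. -/
def factorSubgroup {A : Type*} [Group A] {U : Set A} (s : Semi U) : Subgroup A :=
  Con.liftOn s (wordSubgroup U) (wordSubgroup_eq U)

/-- The set `D_{m,M}` of all conjugates of `a_1` and of `Δ_m²` in `Br_M`, for `1 ≤ m ≤ M`. (For
`M = 1` there is no `a_1`; then `Δ_m² = 1` and the junk value `gen 1 0 = 1` adds nothing.) -/
def conjSet (m M : ℕ) : Set (Braid.Br M) :=
  Group.conjugatesOfSet {Braid.gen M 0, Braid.garside M m ^ 2}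

/-- The semigroup `𝒟_{m,M} = S(Br_M, D_{m,M})`. -/
abbrev DSemi (m M : ℕ) : Type := Semi (conjSet m M)

/-- The relators `x_i⁻¹ b(x_i)`, `b ∈ B_s`, of the group `G(s)`. -/
def groupRels {M : ℕ} {U : Set (Braid.Br M)} (s : Semi U) : Set (FreeGroup (Fin M)) :=
  {r | ∃ (i : Fin M) (b : Braid.Br M), b ∈ factorSubgroup s ∧
    r = (FreeGroup.of i)⁻¹ * Braid.action M b (FreeGroup.of i)}

end Factorization

/-! ### Identities in the braid group: the Garside element and the full twist. -/

namespace Braid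

/-! To a factorization of `Δ_M²` into elements of `D_{m,M}` attach a tuple of `M` elements
generating `F_m`, the images of `x_1, …, x_M`, so that the relations `y = u(y)` of the factors `u`
cut out exactly the preimage of a normal subgroup `K` of `F_m` (`Realizable`). It suffices to reach
the normal closure of `W` by a tuple made of copies of `(x_1, …, x_m)`. The start is the single
factor `Δ_m²`: it acts as conjugation by `x_1 ⋯ x_m`, so `K` says that this product is central
(`realizable_letters`). Two operations are available. Conjugating all factors by one braid performs
Hurwitz moves on the tuple and keeps the product, because the full twist is central. Doubling uses
that `Δ_{2M}²` is a product of half-twists gluing the two halves of the strings and of two copies of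
`Δ_M²` on each half (`full_twist_double`). The factorization is substituted for all four copies,
once conjugated by a braid `g`; this adds the relations moved by `g` (`Realizable.double`). Take `g
= a_1` and a tuple `(a, b, B)` with `B` generating. Then `b` is a word in `B`, the letters of `B`
are fixed by `a_1`, and `a_1` carries `x_2` to `x_1`; so the new relation is `a = b`
(`Realizable.add_relation`). For a relator `x_i = w⁻¹ x_j w`, Hurwitz moves on many copies of the
letters bring `x_j` and `w x_i w⁻¹` to the front (`Hurwitz.exists_front`). This needs `w` positive,
which centrality of `x_1 ⋯ x_m` allows. The relation is added and the moves are undone; induction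
over `W` finishes (`realizable_of_finite`). -/

theorem gen_braid {n i : ℕ} (h : i + 1 < n - 1) :
    gen n i * gen n (i + 1) * gen n i = gen n (i + 1) * gen n i * gen n (i + 1) := by
  have h' : i < n - 1 := by omega
  rw [gen, gen, dif_pos h, dif_pos h', ← mul_inv_eq_one]
  exact PresentedGroup.one_of_mem (Or.inl ⟨⟨i, h'⟩, ⟨i + 1, h⟩, rfl, rfl⟩)

theorem gen_comm {n i j : ℕ} (h : i + 2 ≤ j) : Commute (gen n i) (gen n j) := by
  by_cases hj : j < n - 1
  · have h' : i < n - 1 := by omega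
    rw [gen, gen, dif_pos hj, dif_pos h', Commute, SemiconjBy, ← mul_inv_eq_one]
    exact PresentedGroup.one_of_mem (Or.inr ⟨⟨i, h'⟩, ⟨j, hj⟩, h, rfl⟩)
  · simp [gen, hj]

theorem gen_induction {n : ℕ} {p : Br n → Prop} (hgen : ∀ i, i < n - 1 → p (gen n i))
    (hone : p 1) (hmul : ∀ x y, p x → p y → p (x * y)) (hinv : ∀ x, p x → p x⁻¹) (x : Br n) :
    p x := by
  have hx : x ∈ Subgroup.closure (Set.range (PresentedGroup.of (rels := rels n))) := by
    rw [PresentedGroup.closure_range_of]; trivial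
  induction hx using Subgroup.closure_induction with
  | mem x hx =>
    obtain ⟨i, rfl⟩ := hx
    have := hgen i i.2
    rwa [gen, dif_pos i.2] at this
  | one => exact hone
  | mul x y _ _ hx hy => exact hmul x y hx hy
  | inv x _ hx => exact hinv x hx

/-- The product `a_{i+1} ⋯ a_{i+l}` of `l` consecutive standard generators. -/
def asc (n i l : ℕ) : Br n := ((List.range l).map fun j => gen n (i + j)).prod

/-- The product `a_{i+l} ⋯ a_{i+1}` of `l` consecutive standard generators. -/
def desc (n i : ℕ) : ℕ → Br n
  | 0 => 1
  | l + 1 => gen n (i + l) * desc n i l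

@[simp] theorem asc_zero (n i : ℕ) : asc n i 0 = 1 := by simp [asc]

theorem asc_succ (n i l : ℕ) : asc n i (l + 1) = asc n i l * gen n (i + l) := by
  simp [asc, List.range_succ]

theorem asc_add (n i k l : ℕ) : asc n i (k + l) = asc n i k * asc n (i + k) l := by
  induction l with
  | zero => simp
  | succ l ih => rw [← add_assoc, asc_succ, ih, asc_succ, mul_assoc, add_assoc]

theorem asc_one (n i : ℕ) : asc n i 1 = gen n i := by simp [asc_succ]

theorem garside_zero (n : ℕ) : garside n 0 = 1 := by simp [garside]

theorem garside_succ (n k : ℕ) : garside n (k + 1) = asc n 0 k * garside n k := by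
  simp [garside, List.range_succ, asc]

theorem asc_commute_gen {n i l j : ℕ} (h : i + l + 1 ≤ j) : Commute (asc n i l) (gen n j) := by
  induction l with
  | zero => simp
  | succ l ih =>
    rw [asc_succ]
    exact (ih (by omega)).mul_left (gen_comm (by omega))

theorem asc_commute_asc {n i l j k : ℕ} (h : i + l + 1 ≤ j) :
    Commute (asc n i l) (asc n j k) := by
  induction k with
  | zero => simp
  | succ k ih =>
    rw [asc_succ]
    exact ih.mul_right (asc_commute_gen (by omega))

theorem garside_commute_gen {n k j : ℕ} (h : k ≤ j) : Commute (garside n k) (gen n j) := by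
  induction k with
  | zero => simp [garside_zero]
  | succ k ih =>
    rw [garside_succ]
    exact (asc_commute_gen (by omega)).mul_left (ih (by omega))

theorem asc_mul_gen {n i l : ℕ} (hi : i + 1 < l) (hl : l ≤ n - 1) :
    asc n 0 l * gen n i = gen n (i + 1) * asc n 0 l := by
  induction l, hi using Nat.le_induction with
  | base =>
    have h1 := gen_braid (n := n) (i := i) (by omega)
    have h2 := (asc_commute_gen (n := n) (i := 0) (l := i) (j := i + 1) (by omega)).eq
    simp only [asc_succ, zero_add] at *
    calc asc n 0 i * gen n i * gen n (i + 1) * gen n i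
        = asc n 0 i * (gen n i * gen n (i + 1) * gen n i) := by group
      _ = asc n 0 i * gen n (i + 1) * gen n i * gen n (i + 1) := by rw [h1]; group
      _ = _ := by rw [h2]; group
  | succ l hl' ih =>
    rw [asc_succ, zero_add, mul_assoc, ← (gen_comm (n := n) (i := i) (j := l) (by omega)).eq,
      ← mul_assoc, ih (by omega), mul_assoc]

theorem asc_pow_mul_gen {n i j l : ℕ} (h : i + j < l) (hl : l ≤ n - 1) :
    asc n 0 l ^ j * gen n i = gen n (i + j) * asc n 0 l ^ j := by
  induction j with
  | zero => simp
  | succ j ih =>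
    rw [pow_succ', mul_assoc, ih (by omega), ← mul_assoc, asc_mul_gen (by omega) hl, mul_assoc,
      add_assoc]

theorem asc_one_mul {n k l : ℕ} (h : k < l) (hl : l ≤ n - 1) :
    asc n 0 l * asc n 0 k = asc n 1 k * asc n 0 l := by
  induction k with
  | zero => simp
  | succ k ih =>
    rw [asc_succ, asc_succ, ← mul_assoc, ih (by omega), mul_assoc, zero_add,
      asc_mul_gen (by omega) hl, mul_assoc, add_comm 1 k]

theorem desc_mul_asc {n i j l : ℕ} (h : i + j < l) (hl : l ≤ n - 1) :
    desc n (i + 1) j * asc n 0 l = asc n 0 l * desc n i j := by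
  induction j with
  | zero => simp [desc]
  | succ j ih =>
    rw [desc, desc, mul_assoc, ih (by omega), ← mul_assoc, ← mul_assoc,
      asc_mul_gen (i := i + j) (by omega) hl, add_right_comm]

/-- The last generator of each factor is collected on the right. The descending product gathered so
far passes through the next factor with all indices lowered by one (`desc_mul_asc`), then gains a
new top generator. -/
theorem asc_succ_pow {n k : ℕ} (hk : k + 1 ≤ n - 1) (j i : ℕ) (h : i + j = k + 1) :
    asc n 0 (k + 1) ^ j = asc n 0 k ^ j * desc n i j := by
  induction j generalizing i with
  | zero => simp [desc]
  | succ j ih =>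
    obtain rfl : k = i + j := by omega
    rw [pow_succ, ih (i + 1) (by omega), mul_assoc, desc_mul_asc (by omega) hk, asc_succ,
      pow_succ, desc, zero_add]
    group

/-- The mirror image of `garside_succ`. Using one recursion for each factor of the square encloses
the smaller full twist between an ascending and a descending product. -/
theorem garside_succ' (n k : ℕ) : garside n (k + 1) = garside n k * desc n 0 k := by
  induction k with
  | zero => simp [garside_succ, garside_zero, desc]
  | succ k ih =>
    calc garside n (k + 1 + 1) = asc n 0 k * (gen n k * garside n k) * desc n 0 k := by
          rw [garside_succ, ih, asc_succ, zero_add]; group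
      _ = garside n (k + 1) * desc n 0 (k + 1) := by
          rw [← (garside_commute_gen le_rfl).eq, garside_succ, desc, zero_add]; group

/-- The full twist on `k + 1` strings is the `(k + 1)`-st power of `a_1 ⋯ a_k`. -/
theorem garside_sq {n k : ℕ} (hk : k ≤ n - 1) : garside n (k + 1) ^ 2 = asc n 0 k ^ (k + 1) := by
  induction k with
  | zero => simp [garside_succ, garside_zero]
  | succ k ih =>
    have h1 := asc_succ_pow (n := n) hk (k + 1) 0 (by omega)
    have h2 := ih (by omega)
    calc garside n (k + 1 + 1) ^ 2
        = asc n 0 (k + 1) * garside n (k + 1) * (garside n (k + 1) * desc n 0 (k + 1)) := by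
          rw [pow_two]; nth_rw 1 [garside_succ]; rw [garside_succ' n (k + 1)]
      _ = asc n 0 (k + 1) * (garside n (k + 1) ^ 2 * desc n 0 (k + 1)) := by
          rw [pow_two]; group
      _ = asc n 0 (k + 1) ^ (k + 1 + 1) := by rw [h2, ← h1, ← pow_succ']

/-- Conjugation by `a_1 ⋯ a_{l+1}` raises indices by one but does not take the last generator to a
standard one. Its square closes the cycle, from the last generator to the first. -/
theorem asc_sq_mul_gen {n l : ℕ} (hl : l + 1 ≤ n - 1) :
    asc n 0 (l + 1) ^ 2 * gen n l = gen n 0 * asc n 0 (l + 1) ^ 2 := by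
  have h1 : asc n 0 (l + 1) = gen n 0 * asc n 1 l := by
    rw [add_comm, asc_add, asc_one]
  have h2 := asc_one_mul (n := n) (Nat.lt_succ_self l) hl
  calc asc n 0 (l + 1) ^ 2 * gen n l
      = asc n 0 (l + 1) * (asc n 0 (l + 1) * gen n l) := by rw [pow_two, mul_assoc]
    _ = gen n 0 * (asc n 1 l * asc n 0 (l + 1)) * gen n l := by
        nth_rw 1 [h1]; group
    _ = gen n 0 * asc n 0 (l + 1) * (asc n 0 l * gen n l) := by rw [← h2]; group
    _ = _ := by
        have := asc_succ n 0 l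
        rw [zero_add] at this
        rw [← this, pow_two, mul_assoc]

theorem full_twist_central {n k : ℕ} (hn : n = k + 1) (x : Br n) :
    Commute (garside n n ^ 2) x := by
  subst hn
  rw [garside_sq (by omega)]
  induction x using gen_induction with
  | hone => simp
  | hmul x y hx hy => exact hx.mul_right hy
  | hinv x hx => exact hx.inv_right
  | hgen i hi =>
    obtain ⟨j, rfl⟩ : ∃ j, k = i + j + 1 := ⟨k - i - 1, by omega⟩
    set d := asc (i + j + 1 + 1) 0 (i + j + 1)
    have h1 : d ^ j * gen _ i = gen _ (i + j) * d ^ j := asc_pow_mul_gen (by omega) (by omega)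
    have h2 : d ^ 2 * gen _ (i + j) = gen _ 0 * d ^ 2 := asc_sq_mul_gen (by omega)
    have h3 : d ^ i * gen _ 0 = gen _ (0 + i) * d ^ i := asc_pow_mul_gen (by omega) (by omega)
    rw [zero_add] at h3
    -- The exponent is the number of strings: `d ^ j` raises the generator to the last one, `d ^ 2`
    -- wraps it to the first, and `d ^ i` raises it to its old place.
    have h4 : d ^ (i + j + 1 + 1) = d ^ i * d ^ 2 * d ^ j := by
      rw [← pow_add, ← pow_add]; congr 1; omega
    rw [h4]
    show _ * _ = _ * _
    calc d ^ i * d ^ 2 * d ^ j * gen _ i = d ^ i * (d ^ 2 * (d ^ j * gen _ i)) := by group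
      _ = d ^ i * gen _ 0 * d ^ 2 * d ^ j := by rw [h1, ← mul_assoc (d ^ 2), h2]; group
      _ = _ := by rw [h3]; group

theorem gen_isConj {n i : ℕ} (hi : i < n - 1) : IsConj (gen n 0) (gen n i) := by
  rw [isConj_iff]
  refine ⟨asc n 0 (n - 1) ^ i, ?_⟩
  rw [asc_pow_mul_gen (by omega) le_rfl, zero_add, mul_inv_cancel_right]

/-! ### The action on the free group -/

/-- The generator `x_{i+1}` of the free group, for `i < n` (and `1` for other `i`). -/
def fgen (n i : ℕ) : FreeGroup (Fin n) := if h : i < n then FreeGroup.of ⟨i, h⟩ else 1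

theorem fgen_val {n : ℕ} (i : Fin n) : fgen n i = FreeGroup.of i := by simp [fgen]

theorem action_gen {n i : ℕ} (h : i < n - 1) : action n (gen n i) = genAut ⟨i, h⟩ := by
  rw [gen, dif_pos h, action, PresentedGroup.toGroup.of]

theorem action_gen_self {n i : ℕ} (h : i < n - 1) :
    action n (gen n i) (fgen n i) = fgen n i * fgen n (i + 1) * (fgen n i)⁻¹ := by
  rw [action_gen h, fgen, dif_pos (by omega), fgen, dif_pos (by omega), genAut, twist_of]
  simp

theorem action_gen_succ {n i : ℕ} (h : i < n - 1) :
    action n (gen n i) (fgen n (i + 1)) = fgen n i := by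
  rw [action_gen h, fgen, dif_pos (by omega), fgen, dif_pos (by omega), genAut, twist_of]
  simp

theorem action_gen_of_ne {n i j : ℕ} (h1 : j ≠ i) (h2 : j ≠ i + 1) :
    action n (gen n i) (fgen n j) = fgen n j := by
  by_cases h : i < n - 1
  · rw [action_gen h, fgen]
    split_ifs with hj
    · rw [genAut, twist_of]; simp [h1, h2]
    · simp
  · simp [gen, h]

theorem action_asc_of_lt {n i l j : ℕ} (h : j < i) : action n (asc n i l) (fgen n j) = fgen n j := by
  induction l with
  | zero => simp
  | succ l ih => rw [asc_succ, map_mul, MulAut.mul_apply, action_gen_of_ne (by omega) (by omega), ih]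

theorem action_asc_of_gt {n i l j : ℕ} (h : i + l < j) :
    action n (asc n i l) (fgen n j) = fgen n j := by
  induction l with
  | zero => simp
  | succ l ih =>
    rw [asc_succ, map_mul, MulAut.mul_apply, action_gen_of_ne (by omega) (by omega),
      ih (by omega)]

theorem action_asc_last {n i l : ℕ} (h : i + l < n) :
    action n (asc n i l) (fgen n (i + l)) = fgen n i := by
  induction l with
  | zero => simp
  | succ l ih =>
    rw [asc_succ, map_mul, MulAut.mul_apply, ← add_assoc, action_gen_succ (by omega),
      ih (by omega)]

theorem action_asc_mid {n l j : ℕ} (h : l < n) (hj : j < l) :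
    action n (asc n 0 l) (fgen n j) = fgen n 0 * fgen n (j + 1) * (fgen n 0)⁻¹ := by
  obtain ⟨k, rfl⟩ : ∃ k, l = j + 1 + k := ⟨l - (j + 1), by omega⟩
  have hl : action n (asc n 0 j) (fgen n j) = fgen n 0 := by
    simpa using action_asc_last (n := n) (i := 0) (l := j) (by omega)
  rw [asc_add, map_mul, MulAut.mul_apply, action_asc_of_lt (by omega), asc_succ, map_mul,
    MulAut.mul_apply, zero_add, action_gen_self (by omega), map_mul, map_mul, map_inv, hl,
    action_asc_of_gt (by omega)]

/-- The product `x_1 ⋯ x_k` in the free group on `n` letters. -/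
def fprod (n k : ℕ) : FreeGroup (Fin n) := ((List.range k).map (fgen n)).prod

theorem fprod_zero (n : ℕ) : fprod n 0 = 1 := by simp [fprod]

theorem fprod_succ (n k : ℕ) : fprod n (k + 1) = fprod n k * fgen n k := by
  simp [fprod, List.range_succ]

theorem fprod_self (n : ℕ) : fprod n n = CGrp.prodX n := by
  rw [fprod, CGrp.prodX]
  congr 1
  apply List.ext_getElem
  · simp
  · intro i h1 h2
    have hi : i < n := by simpa using h1
    simp [fgen, hi]

theorem fprod_one (n : ℕ) : fprod n 1 = fgen n 0 := by simp [fprod]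

theorem action_asc_fprod {n k : ℕ} (hk : k < n) :
    action n (asc n 0 (n - 1)) (fprod n k) = fprod n (k + 1) * (fgen n 0)⁻¹ := by
  induction k with
  | zero => simp [fprod_zero, fprod_one]
  | succ k ih =>
    rw [fprod_succ, map_mul, ih (by omega), action_asc_mid (by omega) (by omega),
      fprod_succ n (k + 1)]
    group

theorem action_asc_pow {n k : ℕ} (hk : k < n) :
    action n (asc n 0 (n - 1) ^ k) (fgen n 0) = fprod n k * fgen n k * (fprod n k)⁻¹ := by
  induction k with
  | zero => simp [fprod_zero]
  | succ k ih =>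
    rw [pow_succ', map_mul, MulAut.mul_apply, ih (by omega), map_mul, map_mul, map_inv,
      action_asc_fprod (by omega), action_asc_mid (by omega) (by omega)]
    group

/-- By `action_asc_pow` the orbit is triangular: its `k`-th element is a conjugate of the letter of
index `k` by a product of earlier letters. -/
theorem closure_action_asc_pow (n : ℕ) :
    Subgroup.closure {y | ∃ k < n, y = action n (asc n 0 (n - 1) ^ k) (fgen n 0)} = ⊤ := by
  set E := Subgroup.closure {y | ∃ k < n, y = action n (asc n 0 (n - 1) ^ k) (fgen n 0)}
  have key : ∀ k ≤ n, fprod n k ∈ E ∧ ∀ j < k, fgen n j ∈ E := by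
    intro k
    induction k with
    | zero => intro _; simp [fprod_zero, one_mem]
    | succ k ih =>
      intro hk
      obtain ⟨h1, h2⟩ := ih (by omega)
      have h3 : action n (asc n 0 (n - 1) ^ k) (fgen n 0) ∈ E :=
        Subgroup.subset_closure ⟨k, by omega, rfl⟩
      rw [action_asc_pow (by omega)] at h3
      have h4 : fgen n k ∈ E := by
        have := mul_mem (mul_mem (inv_mem h1) h3) h1
        simpa [mul_assoc] using this
      refine ⟨fprod_succ n k ▸ mul_mem h1 h4, fun j hj => ?_⟩
      rcases Nat.lt_succ_iff_lt_or_eq.mp hj with hj | rfl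
      exacts [h2 j hj, h4]
  rw [eq_top_iff, ← FreeGroup.closure_range_of, Subgroup.closure_le]
  rintro _ ⟨i, rfl⟩
  rw [← fgen_val]
  exact (key n le_rfl).2 i i.2

/-- The full twist acts by conjugation with `x_1 ⋯ x_n`. -/
theorem action_full_twist {n k : ℕ} (hn : n = k + 1) (y : FreeGroup (Fin n)) :
    action n (garside n n ^ 2) y = CGrp.prodX n * y * (CGrp.prodX n)⁻¹ := by
  subst hn
  have hlast : action (k + 1) (asc (k + 1) 0 k) (fgen (k + 1) k) = fgen (k + 1) 0 := by
    simpa using action_asc_last (n := k + 1) (i := 0) (l := k) (by omega)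
  have hk : action (k + 1) (asc (k + 1) 0 k) (fprod (k + 1) k) =
      fprod (k + 1) (k + 1) * (fgen (k + 1) 0)⁻¹ := action_asc_fprod (n := k + 1) (by omega)
  have hP : action (k + 1) (asc (k + 1) 0 k) (CGrp.prodX (k + 1)) = CGrp.prodX (k + 1) := by
    rw [← fprod_self]
    nth_rw 1 [fprod_succ]
    rw [map_mul, hk, hlast, inv_mul_cancel_right]
  have hPj : ∀ j, action (k + 1) (asc (k + 1) 0 k ^ j) (CGrp.prodX (k + 1)) =
      CGrp.prodX (k + 1) := by
    intro j
    induction j with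
    | zero => simp
    | succ j ih => rw [pow_succ, map_mul, MulAut.mul_apply, hP, ih]
  have h0 : action (k + 1) (asc (k + 1) 0 k ^ (k + 1)) (fgen (k + 1) 0) =
      CGrp.prodX (k + 1) * fgen (k + 1) 0 * (CGrp.prodX (k + 1))⁻¹ := by
    have h : action (k + 1) (asc (k + 1) 0 k ^ k) (fgen (k + 1) 0) =
        fprod (k + 1) k * fgen (k + 1) k * (fprod (k + 1) k)⁻¹ :=
      action_asc_pow (n := k + 1) (k := k) (by omega)
    rw [pow_succ', map_mul, MulAut.mul_apply, h, map_mul, map_mul, map_inv, hk, hlast, fprod_self]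
    group
  rw [garside_sq (by omega)]
  -- Two automorphisms are compared on the orbit of the first letter under `a_1 ⋯ a_k`. Both commute
  -- with this braid, the second because the braid fixes `x_1 ⋯ x_n`.
  have hy : y ∈ ((action (k + 1) (asc (k + 1) 0 k ^ (k + 1))).toMonoidHom.eqLocus
      (MulAut.conj (CGrp.prodX (k + 1))).toMonoidHom) := by
    have htop : Subgroup.closure {y | ∃ j < k + 1,
        y = action (k + 1) (asc (k + 1) 0 k ^ j) (fgen (k + 1) 0)} = ⊤ :=
      closure_action_asc_pow (k + 1)
    refine (htop.symm.trans_le ?_) (Subgroup.mem_top y)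
    rw [Subgroup.closure_le]
    rintro _ ⟨j, -, rfl⟩
    show action (k + 1) (asc (k + 1) 0 k ^ (k + 1)) (action (k + 1) (asc (k + 1) 0 k ^ j) _) =
      CGrp.prodX (k + 1) * action (k + 1) (asc (k + 1) 0 k ^ j) _ * (CGrp.prodX (k + 1))⁻¹
    rw [← MulAut.mul_apply, ← map_mul, ((Commute.refl _).pow_pow _ _).eq, map_mul,
      MulAut.mul_apply, h0, map_mul, map_mul, map_inv, hPj]
  exact hy

end Braid

/-! ### Doubling the number of strings. -/

namespace Braid

theorem mul_pow_eq_prod_conj {A : Type*} [Group A] (e t : A) (n : ℕ) :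
    (e * t) ^ n = ((List.range n).map fun k => e ^ (k + 1) * t * (e ^ (k + 1))⁻¹).prod * e ^ n := by
  induction n with
  | zero => simp
  | succ n ih =>
    rw [pow_succ, ih, List.range_succ, List.map_append, List.prod_append]
    simp only [List.map_cons, List.map_nil, List.prod_cons, List.prod_nil, mul_one, pow_succ]
    group

/-- The homomorphism `Br_M → Br_n`, `M ≤ n`, with `a_i ↦ a_i`. -/
def incl {M n : ℕ} (h : M ≤ n) : Br M →* Br n :=
  PresentedGroup.toGroup (f := fun i : Fin (M - 1) => gen n i) (by
    rintro r (⟨i, j, hij, rfl⟩ | ⟨i, j, hij, rfl⟩)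
    · simp only [map_mul, map_inv, FreeGroup.lift_apply_of, mul_inv_eq_one, ← hij]
      exact gen_braid (by omega)
    · simp only [map_mul, map_inv, FreeGroup.lift_apply_of, mul_inv_eq_one]
      exact gen_comm hij)

theorem incl_gen {M n i : ℕ} (h : M ≤ n) (hi : i < M - 1) : incl h (gen M i) = gen n i := by
  rw [gen, dif_pos hi, incl, PresentedGroup.toGroup.of]

theorem incl_asc {M n l : ℕ} (h : M ≤ n) (hl : l ≤ M - 1) :
    incl h (asc M 0 l) = asc n 0 l := by
  induction l with
  | zero => simp
  | succ l ih => rw [asc_succ, asc_succ, map_mul, ih (by omega), incl_gen h (by omega)]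

theorem incl_garside {M n k : ℕ} (h : M ≤ n) (hk : k ≤ M) :
    incl h (garside M k) = garside n k := by
  induction k with
  | zero => simp [garside_zero]
  | succ k ih => rw [garside_succ, garside_succ, map_mul, ih (by omega), incl_asc h (by omega)]

/-- The homomorphism `Br_M → Br_{2M}` with `a_i ↦ a_{M+i}`. -/
def shift (M : ℕ) : Br M →* Br (M + M) :=
  (MulAut.conj (asc (M + M) 0 (M + M - 1) ^ M)).toMonoidHom.comp (incl (Nat.le_add_right M M))

theorem shift_apply {M : ℕ} (u : Br M) :
    shift M u = asc (M + M) 0 (M + M - 1) ^ M * incl (Nat.le_add_right M M) u *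
      (asc (M + M) 0 (M + M - 1) ^ M)⁻¹ := rfl

theorem shift_gen {M i : ℕ} (hi : i < M - 1) : shift M (gen M i) = gen (M + M) (M + i) := by
  rw [shift_apply, incl_gen _ hi, asc_pow_mul_gen (by omega) le_rfl, mul_inv_cancel_right,
    add_comm i]

theorem shift_asc {M l : ℕ} (hl : l ≤ M - 1) : shift M (asc M 0 l) = asc (M + M) M l := by
  induction l with
  | zero => simp
  | succ l ih =>
    rw [asc_succ, asc_succ, map_mul, ih (by omega), zero_add, shift_gen (by omega)]

/-- The action `ρ` is left free so that `ρ = 1` covers the half of the letters which the braid does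
not move. -/
theorem action_equivariant {M n : ℕ} (θ : Br M →* Br n) (ρ : Br M →* MulAut (FreeGroup (Fin M)))
    (j : FreeGroup (Fin M) →* FreeGroup (Fin n))
    (h : ∀ i < M - 1, ∀ k < M,
      action n (θ (gen M i)) (j (fgen M k)) = j (ρ (gen M i) (fgen M k)))
    (u : Br M) (y : FreeGroup (Fin M)) : action n (θ u) (j y) = j (ρ u y) := by
  induction u using gen_induction generalizing y with
  | hone => simp
  | hmul u v hu hv => simp only [map_mul, MulAut.mul_apply, hu, hv]
  | hinv u hu =>
    have := hu ((ρ u)⁻¹ y)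
    rw [MulAut.apply_inv_self] at this
    rw [map_inv, map_inv, map_inv, ← this, MulAut.inv_apply_self]
  | hgen i hi =>
    have : (action n (θ (gen M i))).toMonoidHom.comp j =
        j.comp (ρ (gen M i)).toMonoidHom := by
      ext k
      have := h i hi k k.2
      rwa [fgen_val] at this
    exact DFunLike.congr_fun this y

/-- The inclusion of the free group on the first half of the letters. -/
abbrev inclL (M : ℕ) : FreeGroup (Fin M) →* FreeGroup (Fin (M + M)) :=
  FreeGroup.map (Fin.castAdd M)

/-- The inclusion of the free group on the second half of the letters. -/
abbrev inclR (M : ℕ) : FreeGroup (Fin M) →* FreeGroup (Fin (M + M)) :=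
  FreeGroup.map (Fin.natAdd M)

theorem inclL_fgen {M k : ℕ} (h : k < M) : inclL M (fgen M k) = fgen (M + M) k := by
  have : k < M + M := by omega
  simp [fgen, h, this]

theorem inclR_fgen {M k : ℕ} (h : k < M) : inclR M (fgen M k) = fgen (M + M) (M + k) := by
  simp [fgen, h, Fin.natAdd]

theorem action_gen_transport {M n c : ℕ} (hc : c + M ≤ n)
    (j : FreeGroup (Fin M) →* FreeGroup (Fin n)) (hj : ∀ k < M, j (fgen M k) = fgen n (c + k))
    {i k : ℕ} (hi : i < M - 1) (hk : k < M) :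
    action n (gen n (c + i)) (j (fgen M k)) = j (action M (gen M i) (fgen M k)) := by
  by_cases h1 : k = i
  · subst h1
    rw [action_gen_self hi, map_mul, map_mul, map_inv, hj _ hk, hj _ (by omega),
      action_gen_self (by omega), add_assoc]
  · by_cases h2 : k = i + 1
    · subst h2
      rw [action_gen_succ hi, hj _ hk, hj _ (by omega), ← add_assoc, action_gen_succ (by omega)]
    · rw [action_gen_of_ne h1 h2, hj _ hk, action_gen_of_ne (by omega) (by omega)]

variable {M : ℕ}

theorem action_incl_inclL (u : Br M) (y : FreeGroup (Fin M)) :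
    action (M + M) (incl (Nat.le_add_right M M) u) (inclL M y) = inclL M (action M u y) := by
  refine action_equivariant _ _ _ (fun i hi k hk => ?_) u y
  have := action_gen_transport (c := 0) (n := M + M) (by omega) (inclL M)
    (fun k hk => by rw [inclL_fgen hk, zero_add]) hi hk
  rwa [zero_add, ← incl_gen (Nat.le_add_right M M) hi] at this

theorem action_incl_inclR (u : Br M) (y : FreeGroup (Fin M)) :
    action (M + M) (incl (Nat.le_add_right M M) u) (inclR M y) = inclR M y := by
  refine action_equivariant _ 1 _ (fun i hi k hk => ?_) u y
  rw [incl_gen _ hi, inclR_fgen hk, action_gen_of_ne (by omega) (by omega),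
    MonoidHom.one_apply, MulAut.one_apply, inclR_fgen hk]

theorem action_shift_inclR (u : Br M) (y : FreeGroup (Fin M)) :
    action (M + M) (shift M u) (inclR M y) = inclR M (action M u y) := by
  refine action_equivariant _ _ _ (fun i hi k hk => ?_) u y
  rw [shift_gen hi]
  exact action_gen_transport le_rfl (inclR M) (fun k hk => inclR_fgen hk) hi hk

theorem action_shift_inclL (u : Br M) (y : FreeGroup (Fin M)) :
    action (M + M) (shift M u) (inclL M y) = inclL M y := by
  refine action_equivariant _ 1 _ (fun i hi k hk => ?_) u y
  rw [shift_gen hi, inclL_fgen hk, action_gen_of_ne (by omega) (by omega),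
    MonoidHom.one_apply, MulAut.one_apply, inclL_fgen hk]

/-- The product of the two Coxeter elements of the two halves of the strings. -/
def coxeterPair (M : ℕ) : Br (M + M) :=
  incl (Nat.le_add_right M M) (asc M 0 (M - 1)) * shift M (asc M 0 (M - 1))

/-- A half-twist that exchanges the last strings of the two halves. -/
def bridge (M : ℕ) : Br (M + M) :=
  (shift M (asc M 0 (M - 1)))⁻¹ * gen (M + M) (M - 1) * shift M (asc M 0 (M - 1))

/-- The half-twists that occur in the factorization of the full twist on `2M` strings. -/
def bridges (M : ℕ) : List (Br (M + M)) :=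
  (List.range (M + M)).map fun k =>
    coxeterPair M ^ (k + 1) * bridge M * (coxeterPair M ^ (k + 1))⁻¹

/-- The Coxeter element `a_1 ⋯ a_{2M-1}` is `coxeterPair M * bridge M`. In its `2M`-th power the
bridges are collected on the left as conjugates, leaving `coxeterPair M ^ (2M)`. The Coxeter
elements of the two halves commute and the `M`-th power of each is a full twist, so each half
receives its full twist twice. -/
theorem full_twist_double (hM : 0 < M) :
    garside (M + M) (M + M) ^ 2 = (bridges M).prod *
      (incl (Nat.le_add_right M M) (garside M M ^ 2) *
        (incl (Nat.le_add_right M M) (garside M M ^ 2) *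
          (shift M (garside M M ^ 2) * shift M (garside M M ^ 2)))) := by
  obtain ⟨k, rfl⟩ : ∃ k, M = k + 1 := ⟨M - 1, by omega⟩
  set n := k + 1 + (k + 1) with hn
  have hd : asc n 0 (n - 1) = coxeterPair (k + 1) * bridge (k + 1) := by
    have h1 : n - 1 = k + (1 + k) := by omega
    rw [congrArg (asc n 0) h1, asc_add, asc_add, asc_one, coxeterPair, bridge, incl_asc _ (by omega),
      shift_asc (by omega)]
    simp only [Nat.add_sub_cancel, zero_add]
    simp only [mul_assoc, mul_inv_cancel_left]
    rfl
  have h2 : garside n n ^ 2 = asc n 0 (n - 1) ^ n := garside_sq (n := n) (k := n - 1) le_rfl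
  have h3 : garside (k + 1) (k + 1) ^ 2 = asc (k + 1) 0 k ^ (k + 1) := garside_sq le_rfl
  have hcomm : Commute (incl (Nat.le_add_right _ _) (asc (k + 1) 0 k))
      (shift (k + 1) (asc (k + 1) 0 k)) := by
    rw [incl_asc _ (by omega), shift_asc (by omega)]
    exact asc_commute_asc (by omega)
  have h4 : coxeterPair (k + 1) ^ (k + 1 + (k + 1)) =
      incl (Nat.le_add_right _ _) (asc (k + 1) 0 k) ^ (k + 1) *
        (incl (Nat.le_add_right _ _) (asc (k + 1) 0 k) ^ (k + 1) *
          (shift (k + 1) (asc (k + 1) 0 k) ^ (k + 1) *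
            shift (k + 1) (asc (k + 1) 0 k) ^ (k + 1))) := by
    show (incl (Nat.le_add_right _ _) (asc (k + 1) 0 k) *
      shift (k + 1) (asc (k + 1) 0 k)) ^ (k + 1 + (k + 1)) = _
    rw [hcomm.mul_pow, pow_add _ (k + 1) (k + 1), pow_add _ (k + 1) (k + 1), mul_assoc]
  rw [h2, hd, mul_pow_eq_prod_conj, h3, map_pow, map_pow]
  exact congrArg _ h4

theorem isConj_of_mem_bridges (hM : 0 < M) {u : Br (M + M)} (hu : u ∈ bridges M) :
    IsConj (gen (M + M) 0) u := by
  obtain ⟨k, -, rfl⟩ := List.mem_map.mp hu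
  refine (gen_isConj (i := M - 1) (by omega)).trans (isConj_iff.mpr
    ⟨coxeterPair M ^ (k + 1) * (shift M (asc M 0 (M - 1)))⁻¹, ?_⟩)
  rw [bridge]
  group

/-- A half-twist imposes a single relation on a quotient: its two strings become equal. -/
theorem comp_action_gen_eq_iff {n i : ℕ} (hi : i < n - 1) {H : Type*} [Group H]
    (f : FreeGroup (Fin n) →* H) :
    (∀ y, f (action n (gen n i) y) = f y) ↔ f (fgen n i) = f (fgen n (i + 1)) := by
  constructor
  · intro h
    rw [← h (fgen n (i + 1)), action_gen_succ hi]
  · intro h y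
    have : f.comp (action n (gen n i)).toMonoidHom = f := by
      ext k
      show f (action n (gen n i) (FreeGroup.of k)) = f (FreeGroup.of k)
      rw [← fgen_val]
      by_cases h1 : (k : ℕ) = i
      · rw [h1, action_gen_self hi, map_mul, map_mul, map_inv, ← h, mul_inv_cancel_right]
      · by_cases h2 : (k : ℕ) = i + 1
        · rw [h2, action_gen_succ hi, h]
        · rw [action_gen_of_ne h1 h2]
    exact DFunLike.congr_fun this y

theorem comp_action_conj_eq_iff {n : ℕ} {H : Type*} [Group H] (f : FreeGroup (Fin n) →* H)
    (h u : Br n) :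
    (∀ y, f (action n (h * u * h⁻¹) y) = f y) ↔
      ∀ y, f (action n h (action n u y)) = f (action n h y) := by
  constructor
  · intro hf y
    rw [← hf (action n h y)]
    simp only [map_mul, map_inv, MulAut.mul_apply, MulAut.inv_apply_self]
  · intro hf y
    have := hf ((action n h)⁻¹ y)
    simpa only [map_mul, map_inv, MulAut.mul_apply, MulAut.apply_inv_self] using this

theorem action_coxeterPair_pow_inclL (k : ℕ) (y : FreeGroup (Fin M)) :
    action (M + M) (coxeterPair M ^ k) (inclL M y) =
      inclL M (action M (asc M 0 (M - 1) ^ k) y) := by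
  induction k with
  | zero => simp
  | succ k ih =>
    rw [pow_succ', map_mul, MulAut.mul_apply, ih, coxeterPair, map_mul, MulAut.mul_apply,
      action_shift_inclL, action_incl_inclL, pow_succ', map_mul, MulAut.mul_apply]

theorem action_coxeterPair_pow_inclR (k : ℕ) (y : FreeGroup (Fin M)) :
    action (M + M) (coxeterPair M ^ k) (inclR M y) =
      inclR M (action M (asc M 0 (M - 1) ^ k) y) := by
  induction k with
  | zero => simp
  | succ k ih =>
    rw [pow_succ', map_mul, MulAut.mul_apply, ih, coxeterPair, map_mul, MulAut.mul_apply,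
      action_shift_inclR, action_incl_inclR, pow_succ', map_mul, MulAut.mul_apply]

/-- The half-twists `bridges M` identify the two halves of the letters. -/
theorem comp_action_bridges_iff (hM : 0 < M) {H : Type*} [Group H]
    (f : FreeGroup (Fin (M + M)) →* H) :
    (∀ u ∈ bridges M, ∀ y, f (action (M + M) u y) = f y) ↔
      f.comp (inclL M) = f.comp (inclR M) := by
  have hlast : action M (asc M 0 (M - 1)) (fgen M (M - 1)) = fgen M 0 := by
    simpa using action_asc_last (n := M) (i := 0) (l := M - 1) (by omega)
  -- The bridge is a half-twist between the last letters of the halves. The Coxeter element takes a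
  -- last letter to the first one, so the exponent `k + 1` outside becomes `k` on the first letter.
  have key : ∀ k, (∀ y, f (action (M + M)
      (coxeterPair M ^ (k + 1) * bridge M * (coxeterPair M ^ (k + 1))⁻¹) y) = f y) ↔
      f (inclL M (action M (asc M 0 (M - 1) ^ k) (fgen M 0))) =
        f (inclR M (action M (asc M 0 (M - 1) ^ k) (fgen M 0))) := by
    intro k
    set h := coxeterPair M ^ (k + 1) * (shift M (asc M 0 (M - 1)))⁻¹ with hh
    have h1 : coxeterPair M ^ (k + 1) * bridge M * (coxeterPair M ^ (k + 1))⁻¹ =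
        h * gen (M + M) (M - 1) * h⁻¹ := by
      rw [hh, bridge]; group
    have h2 := comp_action_gen_eq_iff (n := M + M) (i := M - 1) (by omega)
      (f.comp (action (M + M) h).toMonoidHom)
    have h3 : action (M + M) h (fgen (M + M) (M - 1)) =
        inclL M (action M (asc M 0 (M - 1) ^ k) (fgen M 0)) := by
      rw [← inclL_fgen (by omega), hh, map_mul, MulAut.mul_apply, ← map_inv, action_shift_inclL,
        action_coxeterPair_pow_inclL, pow_succ, map_mul, MulAut.mul_apply, hlast]
    have h4 : action (M + M) h (fgen (M + M) (M - 1 + 1)) =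
        inclR M (action M (asc M 0 (M - 1) ^ k) (fgen M 0)) := by
      have : M - 1 + 1 = M + 0 := by omega
      rw [this, ← inclR_fgen (by omega), hh, map_mul, MulAut.mul_apply, ← map_inv,
        action_shift_inclR, action_coxeterPair_pow_inclR, pow_succ, map_mul, MulAut.mul_apply,
        ← hlast, map_inv, MulAut.inv_apply_self, hlast]
    rw [h1, comp_action_conj_eq_iff, ← h3, ← h4]
    exact h2
  constructor
  · intro h
    -- Already the bridges with `k < M` suffice, as the corresponding orbit generates the free
    -- group.
    apply MonoidHom.eq_of_eqOn_dense (closure_action_asc_pow M)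
    rintro _ ⟨k, hk, rfl⟩
    exact (key k).mp (h _ (List.mem_map.mpr ⟨k, List.mem_range.mpr (by omega), rfl⟩))
  · intro h u hu
    obtain ⟨k, -, rfl⟩ := List.mem_map.mp hu
    exact (key k).mpr (DFunLike.congr_fun h _)

end Braid

/-! ### Factorizations and the relations they impose. -/

namespace Factorization

theorem exists_word {A : Type*} [Group A] {U : Set A} (L : List A) (hne : L ≠ [])
    (hL : ∀ u ∈ L, u ∈ U) :
    ∃ w : FreeSemigroup U, wordProd U w = L.prod ∧
      wordSubgroup U w = Subgroup.closure {u | u ∈ L} := by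
  induction L with
  | nil => exact absurd rfl hne
  | cons u L ih =>
    have hu : u ∈ U := hL u (by simp)
    by_cases hL0 : L = []
    · subst hL0
      refine ⟨FreeSemigroup.of ⟨u, hu⟩, by simp [wordProd], ?_⟩
      rw [wordSubgroup_of, Subgroup.zpowers_eq_closure]
      simp
    · obtain ⟨w, hw1, hw2⟩ := ih hL0 fun v hv => hL v (by simp [hv])
      refine ⟨FreeSemigroup.of ⟨u, hu⟩ * w, by simp [← hw1, wordProd], ?_⟩
      rw [wordSubgroup_mul, wordSubgroup_of, hw2, Subgroup.zpowers_eq_closure,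
        ← Subgroup.closure_union]
      congr 1
      ext g
      simp

/-- The normal subgroup generated by the elements `y⁻¹ u(y)`, where `u` runs over the list `L`. -/
def relSubgroup (M : ℕ) (L : List (Braid.Br M)) : Subgroup (FreeGroup (Fin M)) :=
  Subgroup.normalClosure {r | ∃ u ∈ L, ∃ y, r = y⁻¹ * Braid.action M u y}

instance (M : ℕ) (L : List (Braid.Br M)) : (relSubgroup M L).Normal :=
  Subgroup.normalClosure_normal

theorem relSubgroup_le_iff {M : ℕ} {L : List (Braid.Br M)} {N : Subgroup (FreeGroup (Fin M))}
    [N.Normal] : relSubgroup M L ≤ N ↔ ∀ u ∈ L, ∀ y, y⁻¹ * Braid.action M u y ∈ N := by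
  refine Subgroup.normalClosure_subset_iff.symm.trans ?_
  constructor
  · intro h u hu y
    exact h ⟨u, hu, y, rfl⟩
  · rintro h _ ⟨u, hu, y, rfl⟩
    exact h u hu y

theorem mem_relSubgroup {M : ℕ} {L : List (Braid.Br M)} {u : Braid.Br M} (hu : u ∈ L)
    (y : FreeGroup (Fin M)) : y⁻¹ * Braid.action M u y ∈ relSubgroup M L :=
  Subgroup.subset_normalClosure ⟨u, hu, y, rfl⟩

/-- Relations of products follow from `y⁻¹ (uv)(y) = y⁻¹ v(y) · v(y)⁻¹ u(v(y))`, so the factors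
suffice in place of all of `B_s`. Conversely, the letters suffice in place of all `y`, because two
homomorphisms are being compared. -/
theorem normalClosure_groupRels {M : ℕ} {U : Set (Braid.Br M)} (s : Semi U)
    (L : List (Braid.Br M)) (hs : factorSubgroup s = Subgroup.closure {u | u ∈ L}) :
    Subgroup.normalClosure (groupRels s) = relSubgroup M L := by
  apply le_antisymm
  · apply Subgroup.normalClosure_le_normal
    rintro _ ⟨i, b, hb, rfl⟩
    rw [hs] at hb
    suffices h : ∀ y, y⁻¹ * Braid.action M b y ∈ relSubgroup M L from h (FreeGroup.of i)
    induction hb using Subgroup.closure_induction with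
    | mem u hu => exact mem_relSubgroup hu
    | one => intro y; simp [one_mem]
    | mul u v _ _ hu hv =>
      intro y
      have := mul_mem (hv y) (hu (Braid.action M v y))
      simpa [mul_assoc] using this
    | inv u _ hu =>
      intro y
      have := inv_mem (hu ((Braid.action M u)⁻¹ y))
      rw [MulAut.apply_inv_self] at this
      simpa using this
  · rw [relSubgroup_le_iff]
    intro u hu y
    have hu' : u ∈ factorSubgroup s := hs ▸ Subgroup.subset_closure hu
    have : (QuotientGroup.mk' (Subgroup.normalClosure (groupRels s))).comp
        (Braid.action M u).toMonoidHom = QuotientGroup.mk' _ := by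
      ext i
      exact (QuotientGroup.eq.mpr (Subgroup.subset_normalClosure
        (show _ ∈ groupRels s from ⟨i, u, hu', rfl⟩))).symm
    exact QuotientGroup.eq.mp (DFunLike.congr_fun this y).symm

theorem conj_mem_conjSet {m M : ℕ} {u : Braid.Br M} (hu : u ∈ conjSet m M) (g : Braid.Br M) :
    g * u * g⁻¹ ∈ conjSet m M := Group.conj_mem_conjugatesOfSet hu

theorem gen_zero_mem_conjSet (m M : ℕ) : Braid.gen M 0 ∈ conjSet m M :=
  Group.subset_conjugatesOfSet (by simp)

theorem garside_sq_mem_conjSet (m M : ℕ) : Braid.garside M m ^ 2 ∈ conjSet m M :=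
  Group.subset_conjugatesOfSet (by simp)

theorem mem_conjSet_of_isConj {m M : ℕ} {u v : Braid.Br M} (hu : u ∈ conjSet m M)
    (h : IsConj u v) : v ∈ conjSet m M := by
  obtain ⟨g, rfl⟩ := isConj_iff.mp h
  exact conj_mem_conjSet hu g

theorem incl_mem_conjSet {m M n : ℕ} (hm : 1 ≤ m) (hmM : m ≤ M) (h : M ≤ n) {u : Braid.Br M}
    (hu : u ∈ conjSet m M) : Braid.incl h u ∈ conjSet m n := by
  obtain ⟨s, hs, hc⟩ := Group.mem_conjugatesOfSet_iff.mp hu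
  refine mem_conjSet_of_isConj ?_ ((Braid.incl h).map_isConj hc)
  rcases hs with rfl | rfl
  · by_cases hM : 0 < M - 1
    · rw [Braid.incl_gen h hM]
      exact gen_zero_mem_conjSet m n
    -- Here `M = 1` and `gen M 0` is the default value `1`, which still lies in the target set as
    -- `Δ_1²`.
    · obtain rfl : m = 1 := by omega
      have := garside_sq_mem_conjSet 1 n
      simpa [Braid.gen, hM, Braid.garside_succ, Braid.garside_zero] using this
  · rw [map_pow, Braid.incl_garside h hmM]
    exact garside_sq_mem_conjSet m n

/-! ### Realizable tuples: conjugation and doubling. -/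

/-- A presentation of a quotient of `F` by a factorization of a full twist: the elements of the
list `l` are the images of `x_1, …, x_M`, and `K` corresponds to the relations of the group of the
factorization. -/
def Realizable {F : Type*} [Group F] (m : ℕ) (l : List F) (K : Subgroup F) : Prop :=
  ∃ (M : ℕ) (τ : Fin M → F) (L : List (Braid.Br M)), 1 ≤ m ∧ m ≤ M ∧ List.ofFn τ = l ∧
    Subgroup.closure (Set.range τ) = ⊤ ∧ L ≠ [] ∧ (∀ u ∈ L, u ∈ conjSet m M) ∧
    L.prod = Braid.garside M M ^ 2 ∧ relSubgroup M L = K.comap (FreeGroup.lift τ)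

theorem lift_surjective {F ι : Type*} [Group F] {τ : ι → F}
    (h : Subgroup.closure (Set.range τ) = ⊤) : Function.Surjective (FreeGroup.lift τ) := by
  rw [← MonoidHom.range_eq_top, FreeGroup.range_lift_eq_closure, h]

theorem prod_map_conj {A : Type*} [Group A] (g : A) (L : List A) :
    (L.map fun u => g * u * g⁻¹).prod = g * L.prod * g⁻¹ := by
  induction L with
  | nil => simp
  | cons u L ih => simp only [List.map_cons, List.prod_cons, ih]; group

/-- Conjugation of all factors by `h⁻¹`. -/
theorem Realizable.conj {F : Type*} [Group F] {m M : ℕ} {τ τ' : Fin M → F}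
    {K : Subgroup F} (h : Realizable m (List.ofFn τ) K) (g : Braid.Br M)
    (hg : ∀ y, FreeGroup.lift τ' y = FreeGroup.lift τ (Braid.action M g y)) :
    Realizable m (List.ofFn τ') K := by
  obtain ⟨M', τ₀, L, hm, hmM, hτ, hcl, hne, hL, hprod, hrel⟩ := h
  obtain rfl : M = M' := by simpa using (congrArg List.length hτ).symm
  obtain rfl : τ = τ₀ := List.ofFn_injective hτ.symm
  refine ⟨M, τ', L.map fun u => g⁻¹ * u * g⁻¹⁻¹, hm, hmM, rfl, ?_, by simpa using hne, ?_, ?_, ?_⟩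
  · rw [← FreeGroup.range_lift_eq_closure, MonoidHom.range_eq_top]
    intro x
    obtain ⟨y, rfl⟩ := lift_surjective hcl x
    exact ⟨(Braid.action M g)⁻¹ y, by rw [hg, MulAut.apply_inv_self]⟩
  · intro u hu
    obtain ⟨v, hv, rfl⟩ := List.mem_map.mp hu
    exact conj_mem_conjSet (hL v hv) _
  -- The full twist is central, so conjugating every factor does not change the product.
  · rw [prod_map_conj, hprod, ← (Braid.full_twist_central (k := M - 1) (by omega) g⁻¹).eq,
      mul_inv_cancel_right]
  · have h1 : K.comap (FreeGroup.lift τ') =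
        (relSubgroup M L).comap (Braid.action M g).toMonoidHom := by
      rw [hrel, Subgroup.comap_comap]
      ext y
      simp only [Subgroup.mem_comap, hg]
      rfl
    rw [h1]
    apply le_antisymm
    · rw [relSubgroup_le_iff]
      intro u hu y
      obtain ⟨v, hv, rfl⟩ := List.mem_map.mp hu
      have := mem_relSubgroup hv (Braid.action M g y)
      rw [Subgroup.mem_comap]
      simpa using this
    · intro y hy
      have h2 : relSubgroup M L ≤ (relSubgroup M (L.map fun u => g⁻¹ * u * g⁻¹⁻¹)).comap
          (Braid.action M g⁻¹).toMonoidHom := by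
        rw [relSubgroup_le_iff]
        intro u hu y
        have := mem_relSubgroup (List.mem_map_of_mem (f := fun u => g⁻¹ * u * g⁻¹⁻¹) hu)
          (Braid.action M g⁻¹ y)
        rw [Subgroup.mem_comap]
        simpa using this
      have := h2 hy
      rw [Subgroup.mem_comap] at this
      simpa using this

/-- Doubling of the number of strings, with the relations `y = g(y)` added. -/
theorem Realizable.double {F : Type*} [Group F] {m M : ℕ} {τ : Fin M → F}
    {K K' : Subgroup F} [K.Normal] [K'.Normal] (h : Realizable m (List.ofFn τ) K) (g : Braid.Br M)
    (hKK' : K ≤ K')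
    (hg : ∀ y, (FreeGroup.lift τ y)⁻¹ * FreeGroup.lift τ (Braid.action M g y) ∈ K')
    (hK' : ∀ N : Subgroup (FreeGroup (Fin M)), N.Normal → K.comap (FreeGroup.lift τ) ≤ N →
      (K.comap (FreeGroup.lift τ)).map (Braid.action M g).toMonoidHom ≤ N →
      K'.comap (FreeGroup.lift τ) ≤ N) :
    Realizable m (List.ofFn τ ++ List.ofFn τ) K' := by
  obtain ⟨M', τ₀, L, hm, hmM, hτ, hcl, hne, hL, hprod, hrel⟩ := h
  obtain rfl : M = M' := by simpa using (congrArg List.length hτ).symm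
  obtain rfl : τ = τ₀ := List.ofFn_injective hτ.symm
  have hM : 0 < M := by omega
  set ι := Braid.incl (Nat.le_add_right M M)
  set κ := Braid.shift M
  set φ := FreeGroup.lift τ
  -- The factorization `L` replaces each of the four full twists of `full_twist_double`. Only the
  -- last copy is conjugated by `g`; its product is still the full twist.
  set L' := Braid.bridges M ++ (L.map ι ++ (L.map ι ++
    (L.map κ ++ (L.map fun u => g * u * g⁻¹).map κ))) with hL'
  have hφL : (FreeGroup.lift (Fin.append τ τ)).comp (Braid.inclL M) = φ := by
    ext; simp [φ, -Fin.natAdd_eq_addNat]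
  have hφR : (FreeGroup.lift (Fin.append τ τ)).comp (Braid.inclR M) = φ := by
    ext; simp [φ, -Fin.natAdd_eq_addNat]
  have hLK : ∀ u ∈ L, ∀ y, (φ y)⁻¹ * φ (Braid.action M u y) ∈ K := by
    intro u hu y
    have := mem_relSubgroup hu y
    rwa [hrel, Subgroup.mem_comap, map_mul, map_inv] at this
  refine ⟨M + M, Fin.append τ τ, L', hm, by omega, List.ofFn_fin_append _ _, ?_, ?_, ?_, ?_, ?_⟩
  · rw [← FreeGroup.range_lift_eq_closure, MonoidHom.range_eq_top]
    intro x
    obtain ⟨y, rfl⟩ := lift_surjective hcl x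
    exact ⟨Braid.inclL M y, DFunLike.congr_fun hφL y⟩
  · simp [hL', hne]
  · have hι : ∀ u ∈ conjSet m M, ι u ∈ conjSet m (M + M) := fun u hu =>
      incl_mem_conjSet hm hmM _ hu
    have hκ : ∀ u ∈ conjSet m M, κ u ∈ conjSet m (M + M) := fun u hu =>
      conj_mem_conjSet (hι u hu) _
    intro u hu
    simp only [hL', List.mem_append, List.mem_map] at hu
    rcases hu with hu | ⟨v, hv, rfl⟩ | ⟨v, hv, rfl⟩ | ⟨v, hv, rfl⟩ | ⟨_, ⟨v, hv, rfl⟩, rfl⟩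
    · exact mem_conjSet_of_isConj (gen_zero_mem_conjSet _ _) (Braid.isConj_of_mem_bridges hM hu)
    · exact hι v (hL v hv)
    · exact hι v (hL v hv)
    · exact hκ v (hL v hv)
    · exact hκ _ (conj_mem_conjSet (hL v hv) g)
  · rw [Braid.full_twist_double hM, hL']
    simp only [List.prod_append]
    rw [← map_list_prod, ← map_list_prod, ← map_list_prod, prod_map_conj, hprod,
      ← (Braid.full_twist_central (k := M - 1) (by omega) g).eq, mul_inv_cancel_right]
  · apply le_antisymm
    · rw [relSubgroup_le_iff]
      have hext : ∀ u : Braid.Br (M + M), (∀ y, FreeGroup.lift (Fin.append τ τ)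
            ((Braid.inclL M y)⁻¹ * Braid.action (M + M) u (Braid.inclL M y)) ∈ K') →
          (∀ y, FreeGroup.lift (Fin.append τ τ)
            ((Braid.inclR M y)⁻¹ * Braid.action (M + M) u (Braid.inclR M y)) ∈ K') →
          ∀ y, y⁻¹ * Braid.action (M + M) u y ∈
            K'.comap (FreeGroup.lift (Fin.append τ τ)) := by
        intro u h1 h2 y
        have : ((QuotientGroup.mk' K').comp (FreeGroup.lift (Fin.append τ τ))).comp
            (Braid.action (M + M) u).toMonoidHom =
            (QuotientGroup.mk' K').comp (FreeGroup.lift (Fin.append τ τ)) := by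
          ext i
          induction i using Fin.addCases with
          | left i =>
            have := h1 (FreeGroup.of i)
            rw [map_mul, map_inv] at this
            simpa [-Fin.natAdd_eq_addNat] using (QuotientGroup.eq.mpr this).symm
          | right i =>
            have := h2 (FreeGroup.of i)
            rw [map_mul, map_inv] at this
            simpa [-Fin.natAdd_eq_addNat] using (QuotientGroup.eq.mpr this).symm
        rw [Subgroup.mem_comap, map_mul, map_inv]
        exact QuotientGroup.eq.mp (DFunLike.congr_fun this y).symm
      have hL1 : ∀ y, FreeGroup.lift (Fin.append τ τ) (Braid.inclL M y) = φ y :=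
        DFunLike.congr_fun hφL
      have hR1 : ∀ y, FreeGroup.lift (Fin.append τ τ) (Braid.inclR M y) = φ y :=
        DFunLike.congr_fun hφR
      have hιK : ∀ v ∈ L, ∀ y, y⁻¹ * Braid.action (M + M) (ι v) y ∈
          K'.comap (FreeGroup.lift (Fin.append τ τ)) := by
        intro v hv
        refine hext _ (fun y => ?_) fun y => ?_
        · rw [Braid.action_incl_inclL, map_mul, map_inv, hL1, hL1]
          exact hKK' (hLK v hv y)
        · rw [Braid.action_incl_inclR, inv_mul_cancel, map_one]
          exact one_mem _
      have hκK : ∀ v, (∀ y, (φ y)⁻¹ * φ (Braid.action M v y) ∈ K') →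
          ∀ y, y⁻¹ * Braid.action (M + M) (κ v) y ∈
            K'.comap (FreeGroup.lift (Fin.append τ τ)) := by
        intro v hv
        refine hext _ (fun y => ?_) fun y => ?_
        · rw [Braid.action_shift_inclL, inv_mul_cancel, map_one]
          exact one_mem _
        · rw [Braid.action_shift_inclR, map_mul, map_inv, hR1, hR1]
          exact hv y
      intro u hu
      simp only [hL', List.mem_append, List.mem_map] at hu
      rcases hu with hu | ⟨v, hv, rfl⟩ | ⟨v, hv, rfl⟩ | ⟨v, hv, rfl⟩ | ⟨_, ⟨v, hv, rfl⟩, rfl⟩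
      · intro y
        rw [Subgroup.mem_comap, map_mul, map_inv,
          (Braid.comp_action_bridges_iff hM _).mpr (hφL.trans hφR.symm) u hu, inv_mul_cancel]
        exact one_mem _
      · exact hιK v hv
      · exact hιK v hv
      · exact hκK v fun y => hKK' (hLK v hv y)
      · have h1 : ∀ y, QuotientGroup.mk' K' (φ (Braid.action M g y)) = QuotientGroup.mk' K' (φ y) :=
          fun y => (QuotientGroup.eq.mpr (hg y)).symm
        have h2 : ∀ y, QuotientGroup.mk' K' (φ (Braid.action M v y)) = QuotientGroup.mk' K' (φ y) :=
          fun y => (QuotientGroup.eq.mpr (hKK' (hLK v hv y))).symm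
        refine hκK _ fun y => QuotientGroup.eq.mp (Eq.symm ?_)
        refine (Braid.comp_action_conj_eq_iff ((QuotientGroup.mk' K').comp φ) g v).mpr
          (fun y => ?_) y
        exact (h1 _).trans ((h2 y).trans (h1 y).symm)
    · set N := relSubgroup (M + M) L'
      have hLR : (QuotientGroup.mk' N).comp (Braid.inclL M) =
          (QuotientGroup.mk' N).comp (Braid.inclR M) := by
        refine (Braid.comp_action_bridges_iff hM _).mp fun u hu y => ?_
        exact (QuotientGroup.eq.mpr (mem_relSubgroup (by simp [hL', hu]) y)).symm
      have hNLR : N.comap (Braid.inclL M) = N.comap (Braid.inclR M) := by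
        have := congrArg MonoidHom.ker hLR
        rwa [← MonoidHom.comap_ker, ← MonoidHom.comap_ker, QuotientGroup.ker_mk'] at this
      have h1 : relSubgroup M L ≤ N.comap (Braid.inclL M) := by
        rw [relSubgroup_le_iff]
        intro u hu y
        have : ι u ∈ L' := by
          simp only [hL', List.mem_append]
          exact Or.inr (Or.inl (List.mem_map_of_mem hu))
        have := mem_relSubgroup this (Braid.inclL M y)
        rwa [Braid.action_incl_inclL, ← map_inv, ← map_mul] at this
      have h2 : (relSubgroup M L).map (Braid.action M g).toMonoidHom ≤ N.comap (Braid.inclL M) := by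
        rw [Subgroup.map_le_iff_le_comap, relSubgroup_le_iff]
        intro u hu y
        rw [hNLR]
        have : κ (g * u * g⁻¹) ∈ L' := by
          simp only [hL', List.mem_append]
          exact Or.inr (Or.inr (Or.inr (Or.inr (List.mem_map_of_mem
            (List.mem_map_of_mem (f := fun u => g * u * g⁻¹) hu)))))
        -- Evaluated at `g(y)`, the relation of `g u g⁻¹` is the `g`-image of the relation `y⁻¹
        -- u(y)`.
        have := mem_relSubgroup this (Braid.inclR M (Braid.action M g y))
        rw [Braid.action_shift_inclR, ← map_inv, ← map_mul] at this
        simpa [Subgroup.mem_comap] using this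
      have h3 := hK' (N.comap (Braid.inclL M)) inferInstance (hrel ▸ h1) (hrel ▸ h2)
      intro r hr
      -- The bridges make the two halves equal modulo `N`. Hence folding onto one half and including
      -- it as the left half is the identity modulo `N`, and membership in `N` can be tested after
      -- folding.
      set fold : FreeGroup (Fin (M + M)) →* FreeGroup (Fin M) :=
        FreeGroup.lift (Fin.append FreeGroup.of FreeGroup.of)
      have hfold : φ.comp fold = FreeGroup.lift (Fin.append τ τ) := by
        ext i
        induction i using Fin.addCases <;> simp [fold, φ, -Fin.natAdd_eq_addNat]
      have hmk : ((QuotientGroup.mk' N).comp (Braid.inclL M)).comp fold = QuotientGroup.mk' N := by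
        ext i
        induction i using Fin.addCases with
        | left i => simp [fold]
        | right i => simpa [fold, -Fin.natAdd_eq_addNat] using DFunLike.congr_fun hLR (FreeGroup.of i)
      have h4 : fold r ∈ K'.comap φ := by
        rw [Subgroup.mem_comap]
        rw [Subgroup.mem_comap, ← hfold] at hr
        exact hr
      have h5 := h3 h4
      rw [Subgroup.mem_comap, ← QuotientGroup.eq_one_iff] at h5
      rw [← QuotientGroup.eq_one_iff]
      exact (DFunLike.congr_fun hmk r).symm.trans h5

end Factorization

namespace Factorization

/-! ### Hurwitz moves and the addition of a relation. -/

section Hurwitz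

variable {F : Type*} [Group F]

/-- An elementary Hurwitz move. -/
inductive HurwitzMove : List F → List F → Prop
  | mk (A B : List F) (a b : F) : HurwitzMove (A ++ a :: b :: B) (A ++ (a * b * a⁻¹) :: a :: B)

/-- Hurwitz equivalence of tuples of elements of a group. -/
def Hurwitz : List F → List F → Prop := Relation.EqvGen HurwitzMove

theorem Hurwitz.refl (l : List F) : Hurwitz l l := Relation.EqvGen.refl l

theorem Hurwitz.symm {l l' : List F} (h : Hurwitz l l') : Hurwitz l' l :=
  Relation.EqvGen.symm _ _ h

theorem Hurwitz.trans {l₁ l₂ l₃ : List F} (h : Hurwitz l₁ l₂) (h' : Hurwitz l₂ l₃) :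
    Hurwitz l₁ l₃ := Relation.EqvGen.trans _ _ _ h h'

theorem Hurwitz.append_left {l l' : List F} (h : Hurwitz l l') (A : List F) :
    Hurwitz (A ++ l) (A ++ l') := by
  induction h with
  | rel _ _ h =>
    obtain ⟨A', B, a, b⟩ := h
    rw [← List.append_assoc, ← List.append_assoc]
    exact Relation.EqvGen.rel _ _ (HurwitzMove.mk (A ++ A') B a b)
  | refl _ => exact Hurwitz.refl _
  | symm _ _ _ ih => exact ih.symm
  | trans _ _ _ _ _ ih ih' => exact ih.trans ih'

theorem Hurwitz.append_right {l l' : List F} (h : Hurwitz l l') (B : List F) :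
    Hurwitz (l ++ B) (l' ++ B) := by
  induction h with
  | rel _ _ h =>
    obtain ⟨A, B', a, b⟩ := h
    rw [List.append_assoc, List.append_assoc]
    exact Relation.EqvGen.rel _ _ (HurwitzMove.mk A (B' ++ B) a b)
  | refl _ => exact Hurwitz.refl _
  | symm _ _ _ ih => exact ih.symm
  | trans _ _ _ _ _ ih ih' => exact ih.trans ih'

theorem Hurwitz.append {l₁ l₁' l₂ l₂' : List F} (h : Hurwitz l₁ l₁') (h' : Hurwitz l₂ l₂') :
    Hurwitz (l₁ ++ l₂) (l₁' ++ l₂') := (h.append_right l₂).trans (h'.append_left l₁')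

/-- An element can be moved to the left end. -/
theorem Hurwitz.move (A : List F) (b : F) : ∃ A', Hurwitz (A ++ [b]) (b :: A') := by
  induction A with
  | nil => exact ⟨[], Hurwitz.refl _⟩
  | cons a A ih =>
    obtain ⟨A', h⟩ := ih
    refine ⟨(b⁻¹ * a * b) :: A', (h.append_left [a]).trans (Hurwitz.symm ?_)⟩
    have := HurwitzMove.mk [] A' b (b⁻¹ * a * b)
    rw [show b * (b⁻¹ * a * b) * b⁻¹ = a by group] at this
    exact Relation.EqvGen.rel _ _ this

/-- An element can be moved to the left end and conjugated by a member of the tuple. -/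
theorem Hurwitz.cross (A : List F) {x : F} (hx : x ∈ A) (b : F) :
    ∃ A', Hurwitz (A ++ [b]) ((x * b * x⁻¹) :: A') := by
  obtain ⟨A₁, A₂, rfl⟩ := List.append_of_mem hx
  obtain ⟨A₂', h₂⟩ := Hurwitz.move A₂ b
  obtain ⟨A₁', h₁⟩ := Hurwitz.move A₁ (x * b * x⁻¹)
  refine ⟨A₁' ++ x :: A₂', ?_⟩
  have h3 : Hurwitz (A₁ ++ x :: b :: A₂') (A₁ ++ (x * b * x⁻¹) :: x :: A₂') :=
    Relation.EqvGen.rel _ _ (HurwitzMove.mk _ _ _ _)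
  have h4 := h₁.append_right (x :: A₂')
  have h5 := h₂.append_left (A₁ ++ [x])
  simp only [List.append_assoc, List.cons_append, List.nil_append] at h4 h5 ⊢
  exact h5.trans (h3.trans h4)

/-- Each copy of `A` supplies one letter of the word: the copy nearest to `b` conjugates by the last
letter, the farthest by the first. -/
theorem Hurwitz.cross_word (A ws : List F) (hws : ∀ x ∈ ws, x ∈ A) (b : F) :
    ∃ A', Hurwitz ((List.replicate ws.length A).flatten ++ [b])
      ((ws.prod * b * ws.prod⁻¹) :: A') := by
  induction ws with
  | nil => exact ⟨[], by simpa using Hurwitz.refl [b]⟩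
  | cons w ws ih =>
    obtain ⟨A₁, h₁⟩ := ih fun x hx => hws x (by simp [hx])
    obtain ⟨A₂, h₂⟩ := Hurwitz.cross A (hws w (by simp)) (ws.prod * b * ws.prod⁻¹)
    refine ⟨A₂ ++ A₁, ?_⟩
    have h3 := h₁.append_left A
    have h4 := h₂.append_right A₁
    have h5 : (w :: ws).prod * b * (w :: ws).prod⁻¹ =
        w * (ws.prod * b * ws.prod⁻¹) * w⁻¹ := by rw [List.prod_cons]; group
    rw [h5]
    simp only [List.append_assoc, List.cons_append, List.nil_append, List.length_cons,
      List.replicate_succ, List.flatten_cons] at h3 h4 ⊢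
    exact h3.trans h4

/-- Sufficiently many copies of a tuple are equivalent to a tuple that begins with a prescribed
member and a prescribed conjugate of a member, and contains a copy of the tuple further on. -/
theorem Hurwitz.exists_front (A ws : List F) (hws : ∀ x ∈ ws, x ∈ A) {x y : F} (hx : x ∈ A)
    (hy : y ∈ A) {n : ℕ} (hn : ws.length + 3 ≤ n) :
    ∃ B, Hurwitz (List.replicate n A).flatten (y :: (ws.prod * x * ws.prod⁻¹) :: B) ∧
      ∀ z ∈ A, z ∈ B := by
  -- In order, the copies supply `y`, carry out the conjugation, supply `x`, and stay intact as the
  -- copy inside `B`; the last `k` are spare.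
  obtain ⟨k, rfl⟩ : ∃ k, n = 1 + (ws.length + (1 + (1 + k))) := ⟨n - (ws.length + 3), by omega⟩
  obtain ⟨X₁, X₂, hX⟩ := List.append_of_mem hx
  obtain ⟨Y₁, Y₂, hY⟩ := List.append_of_mem hy
  set b := ws.prod * x * ws.prod⁻¹
  set C := (List.replicate k A).flatten
  obtain ⟨X₁', h₁⟩ := Hurwitz.move X₁ x
  obtain ⟨A', h₂⟩ := Hurwitz.cross_word A ws hws x
  obtain ⟨Y₂', h₃⟩ := Hurwitz.move Y₂ b
  obtain ⟨Y₁', h₄⟩ := Hurwitz.move Y₁ y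
  obtain ⟨Y₁'', h₅⟩ := Hurwitz.move Y₁' b
  refine ⟨Y₁'' ++ (Y₂' ++ (A' ++ (X₁' ++ (X₂ ++ (A ++ C))))), ?_, fun z hz => by simp [hz]⟩
  simp only [List.replicate_add, List.flatten_append, List.replicate_one, List.flatten_cons,
    List.flatten_nil, List.append_nil]
  have e1 := (h₁.append_right (X₂ ++ (A ++ C))).append_left
    (A ++ (List.replicate ws.length A).flatten)
  have e2 := (h₂.append_right (X₁' ++ (X₂ ++ (A ++ C)))).append_left A
  have e3 := (h₃.append_right (A' ++ (X₁' ++ (X₂ ++ (A ++ C))))).append_left (Y₁ ++ [y])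
  have e4 := h₄.append_right (b :: (Y₂' ++ (A' ++ (X₁' ++ (X₂ ++ (A ++ C))))))
  have e5 := (h₅.append_right (Y₂' ++ (A' ++ (X₁' ++ (X₂ ++ (A ++ C)))))).append_left [y]
  have hX' : ∀ T, A ++ T = X₁ ++ x :: (X₂ ++ T) := fun T => by
    conv_lhs => rw [hX, List.append_assoc, List.cons_append]
  have hY' : ∀ T, A ++ T = Y₁ ++ y :: (Y₂ ++ T) := fun T => by
    conv_lhs => rw [hY, List.append_assoc, List.cons_append]
  rw [hX' (A ++ C)]
  simp only [List.append_assoc, List.cons_append, List.nil_append] at e1 e2 e3 e4 e5 ⊢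
  refine e1.trans (e2.trans ?_)
  rw [hY' (b :: _)]
  exact e3.trans (e4.trans e5)

theorem lift_fgen {M : ℕ} (τ : Fin M → F) {i : ℕ} (hi : i < M) :
    FreeGroup.lift τ (Braid.fgen M i) = τ ⟨i, hi⟩ := by
  simp [Braid.fgen, hi]

/-- The action of a standard generator on two neighbouring letters, `x_i ↦ x_i x_{i+1} x_i⁻¹` and
`x_{i+1} ↦ x_i`, is the Hurwitz move written on letters. -/
theorem HurwitzMove.exists_braid {l l' : List F} (h : HurwitzMove l l') :
    ∃ (M : ℕ) (τ τ' : Fin M → F) (g : Braid.Br M), List.ofFn τ = l ∧ List.ofFn τ' = l' ∧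
      ∀ y, FreeGroup.lift τ' y = FreeGroup.lift τ (Braid.action M g y) := by
  obtain ⟨A, B, a, b⟩ := h
  set l := A ++ a :: b :: B with hl
  have hlen : l.length = A.length + 2 + B.length := by
    simp only [hl, List.length_append, List.length_cons]; omega
  have hi : A.length < l.length - 1 := by omega
  refine ⟨l.length, l.get, fun j => FreeGroup.lift l.get (Braid.action _
    (Braid.gen l.length A.length) (FreeGroup.of j)), Braid.gen l.length A.length,
    List.ofFn_get l, ?_, ?_⟩
  · apply List.ext_getElem
    · simp only [List.length_ofFn, hl, List.length_append, List.length_cons]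
    · intro j h1 h2
      have hj : j < l.length := by simpa using h1
      rw [List.getElem_ofFn, ← Braid.fgen_val]
      show FreeGroup.lift l.get (Braid.action _ (Braid.gen l.length A.length)
        (Braid.fgen l.length j)) = _
      by_cases hj1 : j = A.length
      · subst hj1
        rw [Braid.action_gen_self hi, map_mul, map_mul, map_inv, lift_fgen _ (by omega),
          lift_fgen _ (by omega)]
        simp [hl]
      · by_cases hj2 : j = A.length + 1
        · subst hj2
          rw [Braid.action_gen_succ hi, lift_fgen _ (by omega)]
          simp [hl]
        · rw [Braid.action_gen_of_ne hj1 hj2, lift_fgen _ hj]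
          simp only [hl, List.get_eq_getElem, List.getElem_append, List.getElem_cons]
          split_ifs <;> first | rfl | omega
  · intro y
    have : FreeGroup.lift (fun j => FreeGroup.lift l.get (Braid.action _
        (Braid.gen l.length A.length) (FreeGroup.of j))) = (FreeGroup.lift l.get).comp
          (Braid.action _ (Braid.gen l.length A.length)).toMonoidHom := by ext; simp
    exact DFunLike.congr_fun this y

theorem Realizable.hurwitz {m : ℕ} {l l' : List F} {K : Subgroup F} (h : Realizable m l K)
    (hl : Hurwitz l l') : Realizable m l' K := by
  suffices Realizable m l K ↔ Realizable m l' K from this.mp h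
  clear h
  induction hl with
  | rel _ _ h =>
    obtain ⟨M, τ, τ', g, rfl, rfl, hg⟩ := h.exists_braid
    refine ⟨fun h => h.conj g hg, fun h => h.conj g⁻¹ fun y => ?_⟩
    rw [hg, map_inv, MulAut.apply_inv_self]
  | refl _ => exact Iff.rfl
  | symm _ _ _ ih => exact ih.symm
  | trans _ _ _ _ _ ih ih' => exact ih.trans ih'

/-- Doubling with the trivial braid lengthens the tuple without new relations; it provides the many
copies needed for Hurwitz moves. -/
theorem Realizable.append_self {m : ℕ} {l : List F} {K : Subgroup F} [K.Normal]
    (h : Realizable m l K) : Realizable m (l ++ l) K := by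
  rw [← List.ofFn_get l] at h ⊢
  exact h.double 1 le_rfl (fun y => by simp [one_mem]) fun N _ h _ => h

/-- The relation `a = b` can be added. -/
theorem Realizable.add_relation {m : ℕ} {a b : F} {B : List F} {K : Subgroup F} [K.Normal]
    (h : Realizable m (a :: b :: B) K) (hB : Subgroup.closure {z | z ∈ B} = ⊤) :
    Realizable m (a :: b :: B ++ a :: b :: B) (K ⊔ Subgroup.normalClosure {a * b⁻¹}) := by
  set l := a :: b :: B with hl
  have hlen : l.length = B.length + 2 := by simp [hl]
  set K' := K ⊔ Subgroup.normalClosure {a * b⁻¹}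
  have hsurj : Function.Surjective (FreeGroup.lift l.get) := by
    obtain ⟨M, τ, L, -, -, hτ, hcl, -⟩ := h
    apply lift_surjective
    rw [eq_top_iff, ← hB, Subgroup.closure_le]
    intro z hz
    obtain ⟨i, hi⟩ := List.mem_iff_get.mp (show z ∈ l by rw [hl]; simp [show z ∈ B from hz])
    exact Subgroup.subset_closure ⟨i, hi⟩
  have h0 : FreeGroup.lift l.get (Braid.fgen l.length 0) = a := by
    rw [lift_fgen _ (by omega)]; rfl
  have h1 : FreeGroup.lift l.get (Braid.fgen l.length (0 + 1)) = b := by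
    rw [lift_fgen _ (by omega)]; rfl
  have hab : a * b⁻¹ ∈ K' :=
    (le_sup_right : _ ≤ K') (Subgroup.subset_normalClosure (Set.mem_singleton _))
  rw [← List.ofFn_get l] at h ⊢
  refine h.double (Braid.gen l.length 0) le_sup_left (fun y => ?_) fun N hN hKN hgN => ?_
  · refine QuotientGroup.eq.mp (Eq.symm ?_)
    refine (Braid.comp_action_gen_eq_iff (n := l.length) (i := 0) (by omega)
      ((QuotientGroup.mk' K').comp (FreeGroup.lift l.get))).mpr ?_ y
    rw [MonoidHom.comp_apply, MonoidHom.comp_apply, h0, h1, ← mul_inv_eq_one, ← map_inv, ← map_mul]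
    exact (QuotientGroup.eq_one_iff _).mpr hab
  -- Entries of `B` sit at positions from `2` on, so words in their letters are fixed by the
  -- half-twist of positions `0` and `1`.
  · have hfix : ∀ c ∈ Subgroup.closure {z | z ∈ B}, ∃ v, FreeGroup.lift l.get v = c ∧
        Braid.action l.length (Braid.gen l.length 0) v = v := by
      intro c hc
      induction hc using Subgroup.closure_induction with
      | mem z hz =>
        obtain ⟨i, hi, rfl⟩ := List.mem_iff_getElem.mp hz
        refine ⟨Braid.fgen l.length (i + 2), ?_, Braid.action_gen_of_ne (by omega) (by omega)⟩
        rw [lift_fgen _ (by omega)]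
        rfl
      | one => exact ⟨1, map_one _, map_one _⟩
      | mul x y _ _ hx hy =>
        obtain ⟨v, hv, hv'⟩ := hx
        obtain ⟨w, hw, hw'⟩ := hy
        exact ⟨v * w, by rw [map_mul, hv, hw], by rw [map_mul, hv', hw']⟩
      | inv x _ hx =>
        obtain ⟨v, hv, hv'⟩ := hx
        exact ⟨v⁻¹, by rw [map_inv, hv], by rw [map_inv, hv']⟩
    obtain ⟨v, hv, hv'⟩ := hfix b (hB ▸ Subgroup.mem_top b)
    have hv1 : v⁻¹ * Braid.fgen l.length (0 + 1) ∈ K.comap (FreeGroup.lift l.get) := by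
      rw [Subgroup.mem_comap, map_mul, map_inv, hv, h1, inv_mul_cancel]
      exact one_mem _
    -- This is the image under the half-twist of the relation `hv1`, which holds because `v` and the
    -- second letter both map to `b`. Comparing the two equates the first two letters modulo `N`.
    have hv2 : v⁻¹ * Braid.fgen l.length 0 ∈ N := by
      refine hgN ⟨_, hv1, ?_⟩
      show Braid.action l.length (Braid.gen l.length 0) _ = _
      rw [map_mul, map_inv, hv', Braid.action_gen_succ (by omega)]
    have h10 : Braid.fgen l.length 0 * (Braid.fgen l.length (0 + 1))⁻¹ ∈ N := by
      apply hN.mem_comm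
      have := mul_mem (inv_mem (hKN hv1)) hv2
      simpa [mul_assoc] using this
    have hmap : K' ≤ N.map (FreeGroup.lift l.get) := by
      have : (N.map (FreeGroup.lift l.get)).Normal := hN.map _ hsurj
      refine sup_le (fun k hk => ?_) (Subgroup.normalClosure_le_normal ?_)
      · obtain ⟨z, rfl⟩ := hsurj k
        exact ⟨z, hKN hk, rfl⟩
      · rintro _ rfl
        exact ⟨_, h10, by rw [map_mul, map_inv, h0, h1]⟩
    intro z hz
    obtain ⟨z', hz', he⟩ := hmap hz
    -- The two elements have the same image, and `N` contains the kernel of the lift because it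
    -- contains the preimage of `K`.
    have : z'⁻¹ * z ∈ N := hKN (by
      rw [Subgroup.mem_comap, map_mul, map_inv, he, inv_mul_cancel]
      exact one_mem _)
    simpa using mul_mem hz' this

end Hurwitz

/-! ### Realizing an arbitrary finite set of relators. -/

section Main

variable {m : ℕ}

/-- The letters `x_1, …, x_m`. -/
def letters (m : ℕ) : List (FreeGroup (Fin m)) := List.ofFn FreeGroup.of

theorem of_mem_letters (i : Fin m) : FreeGroup.of i ∈ letters m :=
  List.mem_ofFn.mpr ⟨i, rfl⟩

theorem closure_eq_top_of_letters {B : List (FreeGroup (Fin m))} (h : ∀ z ∈ letters m, z ∈ B) :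
    Subgroup.closure {z | z ∈ B} = ⊤ := by
  rw [eq_top_iff, ← FreeGroup.closure_range_of, Subgroup.closure_le]
  rintro _ ⟨i, rfl⟩
  exact Subgroup.subset_closure (h _ (of_mem_letters i))

/-- The relators which say that `x_1 ⋯ x_m` is central. -/
def centralRels (m : ℕ) : Set (FreeGroup (Fin m)) :=
  Set.range fun i => (FreeGroup.of i)⁻¹ * CGrp.prodX m * FreeGroup.of i * (CGrp.prodX m)⁻¹

/-- The normal subgroup generated by the commutators of `x_1 ⋯ x_m` with the letters. -/
abbrev centralSubgroup (m : ℕ) : Subgroup (FreeGroup (Fin m)) :=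
  Subgroup.normalClosure (centralRels m)

theorem prodX_mem_center :
    QuotientGroup.mk' (centralSubgroup m) (CGrp.prodX m) ∈
      Subgroup.center (FreeGroup (Fin m) ⧸ centralSubgroup m) := by
  rw [Subgroup.mem_center_iff]
  intro q
  obtain ⟨w, rfl⟩ := QuotientGroup.mk'_surjective _ q
  have : (MulAut.conj (QuotientGroup.mk' (centralSubgroup m) (CGrp.prodX m))).toMonoidHom.comp
      (QuotientGroup.mk' (centralSubgroup m)) = QuotientGroup.mk' (centralSubgroup m) := by
    ext i
    have : (QuotientGroup.mk' (centralSubgroup m)) _ = 1 := (QuotientGroup.eq_one_iff _).mpr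
      (Subgroup.subset_normalClosure (Set.mem_range_self i) :
        _ ∈ Subgroup.normalClosure (centralRels m))
    rw [mul_assoc, mul_assoc, map_mul, map_inv, inv_mul_eq_one, ← mul_assoc, map_mul, map_mul,
      map_inv] at this
    exact this.symm
  have h := DFunLike.congr_fun this w
  exact (mul_inv_eq_iff_eq_mul.mp h).symm

theorem realizable_letters (hm : 1 ≤ m) :
    Realizable m (letters m) (centralSubgroup m) := by
  have hlift : FreeGroup.lift (FreeGroup.of (α := Fin m)) = MonoidHom.id _ := by ext; simp
  refine ⟨m, FreeGroup.of, [Braid.garside m m ^ 2], hm, le_rfl, rfl, FreeGroup.closure_range_of _,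
    by simp, by simpa using garside_sq_mem_conjSet m m, by simp, ?_⟩
  rw [hlift, Subgroup.comap_id]
  apply le_antisymm
  · rw [relSubgroup_le_iff]
    intro u hu y
    rw [List.mem_singleton.mp hu, Braid.action_full_twist (k := m - 1) (by omega)]
    refine QuotientGroup.eq.mp ?_
    have := Subgroup.mem_center_iff.mp (prodX_mem_center (m := m))
      (QuotientGroup.mk' (centralSubgroup m) y)
    show QuotientGroup.mk' (centralSubgroup m) y = QuotientGroup.mk' (centralSubgroup m) _
    rw [map_mul, map_mul, map_inv, ← this, mul_inv_cancel_right]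
  · apply Subgroup.normalClosure_le_normal
    rintro _ ⟨i, rfl⟩
    have := mem_relSubgroup (List.mem_singleton_self (Braid.garside m m ^ 2)) (FreeGroup.of i)
    rw [Braid.action_full_twist (k := m - 1) (by omega)] at this
    simpa [mul_assoc] using this

/-- Modulo the centre, every word is equal to a positive word. -/
theorem exists_positive_word (w : FreeGroup (Fin m)) :
    ∃ ws : List (FreeGroup (Fin m)), (∀ x ∈ ws, x ∈ letters m) ∧
      QuotientGroup.mk' (centralSubgroup m) (ws.prod * w⁻¹) ∈
        Subgroup.center (FreeGroup (Fin m) ⧸ centralSubgroup m) := by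
  induction w using FreeGroup.induction_on with
  | C1 => exact ⟨[], by simp, by simp [one_mem]⟩
  | of i => exact ⟨[FreeGroup.of i], by simp [of_mem_letters], by simp [one_mem]⟩
  | inv_of i _ =>
    obtain ⟨X₁, X₂, hX⟩ := List.append_of_mem (of_mem_letters i)
    -- Deleting `x_i` from `x_1 ⋯ x_m`, read cyclically from the place after it, leaves `X₂ X₁`.
    -- Then `X₂ X₁ x_i` is a conjugate of `x_1 ⋯ x_m`, hence central.
    refine ⟨X₂ ++ X₁, fun x hx => ?_, ?_⟩
    · rw [hX]
      rcases List.mem_append.mp hx with h | h <;> simp [h]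
    · have hP : CGrp.prodX m = X₁.prod * FreeGroup.of i * X₂.prod := by
        have : CGrp.prodX m = (letters m).prod := rfl
        rw [this, hX, List.prod_append, List.prod_cons, mul_assoc]
      have h1 : (X₂ ++ X₁).prod * (FreeGroup.of i)⁻¹⁻¹ =
          (X₁.prod * FreeGroup.of i)⁻¹ * CGrp.prodX m * (X₁.prod * FreeGroup.of i) := by
        rw [hP, List.prod_append]; group
      have h2 := Subgroup.mem_center_iff.mp (prodX_mem_center (m := m))
        (QuotientGroup.mk' _ (X₁.prod * FreeGroup.of i))
      have h3 : QuotientGroup.mk' (centralSubgroup m) ((X₂ ++ X₁).prod * (FreeGroup.of i)⁻¹⁻¹) =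
          QuotientGroup.mk' (centralSubgroup m) (CGrp.prodX m) := by
        rw [h1, map_mul, map_mul, map_inv, mul_assoc, ← h2, inv_mul_cancel_left]
      rw [h3]
      exact prodX_mem_center
  | mul v w hv hw =>
    obtain ⟨vs, hvs, hv⟩ := hv
    obtain ⟨ws, hws, hw⟩ := hw
    refine ⟨vs ++ ws, fun x hx => (List.mem_append.mp hx).elim (hvs x) (hws x), ?_⟩
    have h1 : (vs ++ ws).prod * (v * w)⁻¹ = vs.prod * (ws.prod * w⁻¹) * v⁻¹ := by
      rw [List.prod_append]; group
    have h2 := Subgroup.mem_center_iff.mp hw (QuotientGroup.mk' _ vs.prod)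
    rw [h1, map_mul, map_mul, h2, mul_assoc, ← map_mul]
    exact mul_mem hw hv

theorem conj_congr_of_mem_center {v w : FreeGroup (Fin m)}
    (h : QuotientGroup.mk' (centralSubgroup m) (v * w⁻¹) ∈
      Subgroup.center (FreeGroup (Fin m) ⧸ centralSubgroup m)) (z : FreeGroup (Fin m)) :
    v * z * v⁻¹ * (w * z * w⁻¹)⁻¹ ∈ centralSubgroup m := by
  have h1 := Subgroup.mem_center_iff.mp h (QuotientGroup.mk' _ (w * z * w⁻¹))
  refine (QuotientGroup.eq_one_iff _).mp ?_
  have h2 : v * z * v⁻¹ * (w * z * w⁻¹)⁻¹ =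
      (v * w⁻¹) * (w * z * w⁻¹) * (v * w⁻¹)⁻¹ * (w * z * w⁻¹)⁻¹ := by group
  show QuotientGroup.mk' (centralSubgroup m) _ = 1
  rw [h2, map_mul, map_mul, map_mul, ← h1, map_inv, map_inv, mul_inv_cancel_right, mul_inv_cancel]

/-- Words that differ by a central element conjugate alike, so the relation `y = v x v⁻¹` for the
positive word `v` may stand for the given relator with `w`. -/
theorem mem_iff_of_central {N : Subgroup (FreeGroup (Fin m))} [N.Normal]
    (hN : centralSubgroup m ≤ N) {v w : FreeGroup (Fin m)}
    (h : QuotientGroup.mk' (centralSubgroup m) (v * w⁻¹) ∈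
      Subgroup.center (FreeGroup (Fin m) ⧸ centralSubgroup m)) (x y : FreeGroup (Fin m)) :
    y * (v * x * v⁻¹)⁻¹ ∈ N ↔ x⁻¹ * w⁻¹ * y * w ∈ N := by
  have h1 : y * (v * x * v⁻¹)⁻¹ = w * x * (x⁻¹ * w⁻¹ * y * w) * (w * x)⁻¹ *
      (v * x * v⁻¹ * (w * x * w⁻¹)⁻¹)⁻¹ := by group
  rw [h1, Subgroup.mul_mem_cancel_right _ (inv_mem (hN (conj_congr_of_mem_center h x)))]
  constructor
  · intro h2
    have := Subgroup.Normal.conj_mem inferInstance _ h2 (w * x)⁻¹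
    simpa [mul_assoc] using this
  · exact fun h2 => Subgroup.Normal.conj_mem inferInstance _ h2 _

/-- Each relator is added by one doubling, preceded by enough trivial doublings; hence a power of
two copies of the letters. -/
theorem realizable_of_finite (hm : 1 ≤ m) {W : Set (FreeGroup (Fin m))} (hfin : W.Finite)
    (hW : ∀ r ∈ W, CGrp.IsCRelator r) :
    ∃ n, Realizable m (List.replicate (2 ^ n) (letters m)).flatten
      (centralSubgroup m ⊔ Subgroup.normalClosure W) := by
  induction W, hfin using Set.Finite.induction_on with
  | empty => exact ⟨0, by simpa using realizable_letters hm⟩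
  | @insert r W _ _ ih =>
    obtain ⟨n, hn⟩ := ih fun s hs => hW s (Set.mem_insert_of_mem _ hs)
    set K := centralSubgroup m ⊔ Subgroup.normalClosure W
    have hsucc : ∀ k, (List.replicate (2 ^ (k + 1)) (letters m)).flatten =
        (List.replicate (2 ^ k) (letters m)).flatten ++
          (List.replicate (2 ^ k) (letters m)).flatten := fun k => by
      rw [pow_succ, mul_two, List.replicate_add, List.flatten_append]
    have hK : ∀ k, n ≤ k → Realizable m (List.replicate (2 ^ k) (letters m)).flatten K := by
      intro k hk
      induction k, hk using Nat.le_induction with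
      | base => exact hn
      | succ k _ ih => rw [hsucc]; exact ih.append_self
    obtain ⟨i, j, w, rfl⟩ := hW r (Set.mem_insert _ _)
    obtain ⟨ws, hws, hcen⟩ := exists_positive_word w
    set k := max n (ws.length + 3)
    have hk : ws.length + 3 ≤ 2 ^ k :=
      (le_max_right n _).trans (Nat.lt_two_pow_self).le
    obtain ⟨B, hB, hBX⟩ := Hurwitz.exists_front (letters m) ws hws (of_mem_letters i)
      (of_mem_letters j) hk
    have h1 := ((hK k (le_max_left _ _)).hurwitz hB).add_relation (closure_eq_top_of_letters hBX)
    -- Undoing the Hurwitz moves on each half restores a tuple of copies of the letters, so the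
    -- induction can go on.
    have h2 := h1.hurwitz (hB.symm.append hB.symm)
    refine ⟨k + 1, ?_⟩
    rw [hsucc]
    convert h2 using 1
    set r := (FreeGroup.of i)⁻¹ * w⁻¹ * FreeGroup.of j * w
    set r' := FreeGroup.of j * (ws.prod * FreeGroup.of i * ws.prod⁻¹)⁻¹
    have hiff : ∀ N : Subgroup (FreeGroup (Fin m)), N.Normal → centralSubgroup m ≤ N →
        (r' ∈ N ↔ r ∈ N) := fun N _ hN => mem_iff_of_central hN hcen _ _
    apply le_antisymm
    · refine sup_le (le_sup_left.trans le_sup_left) (Subgroup.normalClosure_le_normal ?_)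
      rintro s (rfl | hs)
      · refine (hiff _ inferInstance (le_sup_left.trans le_sup_left)).mp ?_
        exact (le_sup_right : _ ≤ K ⊔ Subgroup.normalClosure {r'})
          (Subgroup.subset_normalClosure (Set.mem_singleton _))
      · exact ((le_sup_right : _ ≤ K).trans (le_sup_left : K ≤ K ⊔ Subgroup.normalClosure {r'}))
          (Subgroup.subset_normalClosure hs)
    · refine sup_le (sup_le_sup_left (Subgroup.normalClosure_mono (Set.subset_insert _ _)) _)
        (Subgroup.normalClosure_le_normal ?_)
      rintro s rfl
      refine (hiff _ inferInstance le_sup_left).mpr ?_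
      exact (le_sup_right : _ ≤ centralSubgroup m ⊔ Subgroup.normalClosure (insert r W))
        (Subgroup.subset_normalClosure (Set.mem_insert _ _))

end Main

end Factorization

/-! ### From the realized presentation to a `C`-isomorphism. -/

namespace CGrp

theorem CIsomorphic.trans {G H J : Type*} [Group G] [Group H] [Group J] {S : Set G} {T : Set H}
    {R : Set J} (h : CIsomorphic S T) (h' : CIsomorphic T R) : CIsomorphic S R := by
  obtain ⟨e, he, he'⟩ := h
  obtain ⟨f, hf, hf'⟩ := h'
  exact ⟨e.trans f, fun g hg => hf _ (he g hg), fun g hg => he' _ (hf' g hg)⟩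

/-- A surjection of free groups that sends letters to letters and each letter is the image of a
letter induces a `C`-isomorphism of presented groups if the kernels fit. -/
theorem cIsomorphic_of_lift {m M : ℕ} {W : Set (FreeGroup (Fin m))} {R : Set (FreeGroup (Fin M))}
    (τ : Fin M → Fin m) (hτ : Function.Surjective τ)
    (hR : Subgroup.normalClosure R =
      (Subgroup.normalClosure W).comap (FreeGroup.lift fun p => FreeGroup.of (τ p))) :
    CIsomorphic (presGens W) (presGens R) := by
  set φ : FreeGroup (Fin M) →* FreeGroup (Fin m) := FreeGroup.lift fun p => FreeGroup.of (τ p)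
  set ψ : FreeGroup (Fin M) →* PresentedGroup W := (PresentedGroup.mk W).comp φ
  have hφ : Function.Surjective φ := by
    apply Factorization.lift_surjective
    rw [← FreeGroup.closure_range_of]
    congr 1
    exact hτ.range_comp FreeGroup.of
  have hψ : Function.Surjective ψ := (PresentedGroup.mk_surjective W).comp hφ
  have hker : Subgroup.normalClosure R = ψ.ker := by
    rw [hR, ← MonoidHom.comap_ker]
    congr 1
    exact (QuotientGroup.ker_mk' _).symm
  let e : PresentedGroup R ≃* PresentedGroup W :=
    (QuotientGroup.quotientMulEquivOfEq hker).trans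
      (QuotientGroup.quotientKerEquivOfSurjective ψ hψ)
  have he : ∀ p, e (PresentedGroup.of p) = PresentedGroup.of (τ p) := fun p => by
    show ψ (FreeGroup.of p) = _
    simp [ψ, φ, PresentedGroup.of]
  refine ⟨e.symm, ?_, ?_⟩
  · intro g hg
    obtain ⟨s, ⟨i, rfl⟩, hc⟩ := Group.mem_conjugatesOfSet_iff.mp hg
    obtain ⟨p, rfl⟩ := hτ i
    refine Group.mem_conjugatesOfSet_iff.mpr ⟨_, ⟨p, rfl⟩, ?_⟩
    have := e.symm.toMonoidHom.map_isConj hc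
    change IsConj (e.symm.toMonoidHom (PresentedGroup.of (τ p))) _ at this
    rwa [← he p, MulEquiv.toMonoidHom_eq_coe, MonoidHom.coe_coe, MulEquiv.symm_apply_apply] at this
  · intro g hg
    obtain ⟨s, ⟨p, rfl⟩, hc⟩ := Group.mem_conjugatesOfSet_iff.mp hg
    refine Group.mem_conjugatesOfSet_iff.mpr ⟨_, ⟨τ p, rfl⟩, ?_⟩
    have := e.toMonoidHom.map_isConj hc
    rw [MulEquiv.toMonoidHom_eq_coe, MonoidHom.coe_coe, he p] at this
    exact this

end CGrp

theorem mainTheorem6 {m : ℕ} (hm : 1 ≤ m) {G : Type*} [Group G] (S : Set G)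
    (hG : CGrp.InCDelta m S) :
    ∃ M : ℕ, m ≤ M ∧ ∃ s : Factorization.DSemi m M,
      Factorization.prodHom (Factorization.conjSet m M) s = Braid.garside M M ^ 2 ∧
      CGrp.CIsomorphic S (CGrp.presGens (Factorization.groupRels s)) := by
  obtain ⟨-, W, hfin, hW, hcen, hS⟩ := hG
  obtain ⟨n, M, τ, L, -, hmM, hτ, -, hne, hL, hprod, hrel⟩ :=
    Factorization.realizable_of_finite hm hfin hW
  -- The class `𝒞_{Δ²,m}` enters here: the central relations forced by `Δ_m²` already belong to `W`.
  have hK : Factorization.centralSubgroup m ⊔ Subgroup.normalClosure W =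
      Subgroup.normalClosure W := by
    refine sup_eq_right.mpr (Subgroup.normalClosure_mono ?_)
    rintro _ ⟨i, rfl⟩
    exact hcen i
  rw [hK] at hrel
  -- The tuple consists of letters and contains every letter. This makes the isomorphism match
  -- `C`-generators in both directions.
  have hmem : ∀ x, x ∈ List.ofFn τ ↔ ∃ i, FreeGroup.of i = x := by
    intro x
    rw [hτ, List.mem_flatten]
    simp [List.mem_replicate, Factorization.letters, List.mem_ofFn]
  choose σ hσ using fun p => (hmem (τ p)).mp (List.mem_ofFn.mpr ⟨p, rfl⟩)
  obtain rfl : (fun p => FreeGroup.of (σ p)) = τ := funext hσ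
  have hsurj : Function.Surjective σ := fun i => by
    obtain ⟨p, hp⟩ := List.mem_ofFn.mp ((hmem _).mpr ⟨i, rfl⟩)
    exact ⟨p, FreeGroup.of_injective hp⟩
  obtain ⟨w, hw1, hw2⟩ := Factorization.exists_word L hne hL
  refine ⟨M, hmM, (w : Factorization.DSemi m M), hw1.trans hprod, hS.trans ?_⟩
  exact CGrp.cIsomorphic_of_lift σ hsurj
    ((Factorization.normalClosure_groupRels (w : Factorization.DSemi m M) L hw2).trans hrel)
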